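/- **Setting.** Let $Q=[-1,1]^2$, let $\varphi_k(t)=\sqrt{k+1/2}\,(2^kk!)^{-1}\frac{d^k}{dt^k}(t^2-1)^k$, $k\ge 0$, be the orthonormal Legendre polynomials, and write $\langle f,\varphi_{k,j}\rangle=\int_Q f(t,\tau)\varphi_k(t)\varphi_j(\tau)\,dt\,d\tau$ for real $f\in L_2(Q)$. For $1\le s<\infty$ and $\mu_1,\mu_2>0$ let $L^{\overline\mu}_{s,2}$ be the class of all $f\in L_2(Q)$ with $$\|f\|_{s,\overline\mu}=\Big(\sum_{k,j\ge 0}\max(1,k)^{s\mu_1}\max(1,j)^{s\mu_2}|\langle f,\varphi_{k,j}\rangle|^s\Big)^{1/s}\le 1 .$$ For an integer $r\ge 1$ put $f^{(0,r)}=\sum_{k\ge 0}\sum_{j\ge r}\langle f,\varphi_{k,j}\rangle\varphi_k(t)\varphi_j^{(r)}(\tau)$ (sum in $L_2(Q)$). Let $1\le p\le\infty$ and $0<\delta<1$; a sequence $g=(g_{k,j})$ of real numbers is a $\delta$-perturbation of $f$ if $\|(\langle f,\varphi_{k,j}\rangle-g_{k,j})_{k,j}\|_{\ell_p}\le\delta$.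 For a finite set $\Omega$ of lattice points $(k,j)$, $k\ge 0$, $j\ge r$, and an arbitrary map $\psi:\mathbb R^\Omega\to L_2(Q)$ let $$\varepsilon_\delta(\psi,\Omega)=\sup_{f\in L^{\overline\mu}_{s,2}}\ \sup_{g}\ \|f^{(0,r)}-\psi((g_{k,j})_{(k,j)\in\Omega})\|_{L_2},$$ where $g$ runs over the $\delta$-perturbations of $f$, and let $R_{N,\delta}=\inf_{\operatorname{card}\Omega\le N}\inf_\psi\varepsilon_\delta(\psi,\Omega)$ be the minimal radius of Galerkin information. For $\gamma\ge1$, $n\in\mathbb N$ the truncation method $\mathcal D_{n,\gamma}$ uses the hyperbolic cross $\Gamma_{n,\gamma}=\{(k,j):k^\gamma j\le n,\ 0\le k\le n^{1/\gamma},\ r\le j\le n\}$ and maps $(g_{k,j})$ to $\sum_{(k,j)\in\Gamma_{n,\gamma}}g_{k,j}\varphi_k(t)\varphi_j^{(r)}(\tau)$; its error is $\varepsilon_\delta(\mathcal D_{n,\gamma})=\varepsilon_\delta(\mathcal D_{n,\gamma},\Gamma_{n,\gamma})$. **Theorem.** Let $r\ge1$, $1\le s<2$, $1\le p\le\infty$,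 $\mu_2>2r-\frac1s+\frac12$ and $\mu_1\ge a$, where $$a=\mu_2-2r+\tfrac1s-\tfrac12,\qquad \beta=\mu_2-\tfrac1p+\tfrac1s .$$ Then for every $f\in L^{\overline\mu}_{s,2}$ the series of $f^{(0,r)}$ converges unconditionally in $L_2(Q)$. Below, $A\asymp B$ means $c\,B\le A\le C\,B$ with constants $0<c\le C$; $\preceq$ means $\le$ up to a positive constant factor. The constants in the conclusions depend only on $r,s,p,\mu_1,\mu_2$, on $\gamma$ where it occurs, and on the constants in the hypotheses $N\asymp\dots$, $n\asymp\dots$. They do not depend on $\delta,N,n$. a) Suppose $\mu_1>a$. If $N\ge1$ and $N\asymp\delta^{-1/\beta}$, then $$R_{N,\delta}\asymp N^{-a}\asymp\delta^{a/\beta}\qquad(0<\delta<1).$$ These order-optimal estimates are attained by the truncation method with any $1<\gamma\le\mu_1/a$ and $n\asymp\delta^{-1/\beta}$: for all such $n$, $\varepsilon_\delta(\mathcal D_{n,\gamma})\asymp\delta^{a/\beta}$ for $0<\delta<1$; and for all sufficiently small $\delta$ and all $N\asymp\delta^{-1/\beta}$ there is an $n\asymp\delta^{-1/\beta}$ with $\operatorname{card}\Gamma_{n,\gamma}\le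 N$, $\varepsilon_\delta(\mathcal D_{n,\gamma})\preceq N^{-a}$ and $\varepsilon_\delta(\mathcal D_{n,\gamma})\preceq\delta^{a/\beta}$. b) If $N\ge2$ and $N\asymp\delta^{-1/\beta}\ln\frac1\delta$, then for $0<\delta<1$ $$N^{-a}\preceq R_{N,\delta}\preceq (N/\ln N)^{-a},\qquad \delta^{a/\beta}\ln^{-a}\tfrac1\delta\preceq R_{N,\delta}\preceq\delta^{a/\beta}.$$ The upper bounds are attained by the truncation method with $\gamma=1$ and $n\asymp\delta^{-1/\beta}$: for all such $n$, $\varepsilon_\delta(\mathcal D_{n,1})\preceq\delta^{a/\beta}$ for $0<\delta<1$; and for all sufficiently small $\delta$ and all $N\asymp\delta^{-1/\beta}\ln\frac1\delta$ there is an $n\asymp\delta^{-1/\beta}$ with $\operatorname{card}\Gamma_{n,1}\le N$, $\varepsilon_\delta(\mathcal D_{n,1})\preceq(N/\ln N)^{-a}$ and $\varepsilon_\delta(\mathcal D_{n,1})\preceq\delta^{a/\beta}$. -/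

import Mathlib

open MeasureTheory
open scoped ENNReal

noncomputable section

/-- The Legendre polynomials orthonormal on `[-1,1]`, by Rodrigues' formula. -/
def legendreON (k : ℕ) : Polynomial ℝ :=
  Polynomial.C (Real.sqrt (k + 1 / 2) * (2 ^ k * (k.factorial : ℝ))⁻¹) *
    Polynomial.derivative^[k] ((Polynomial.X ^ 2 - 1) ^ k)

/-- The square `Q = [-1,1]²`. -/
def squareQ : Set (ℝ × ℝ) := Set.Icc (-1) 1 ×ˢ Set.Icc (-1) 1

/-- Lebesgue measure on `Q`. -/
def measQ : Measure (ℝ × ℝ) := volume.restrict squareQ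

/-- The real space `L₂(Q)`. -/
abbrev L2Q : Type := Lp ℝ 2 measQ

/-- The function `(t, τ) ↦ φ_k(t) φ_j^{(r)}(τ)`. -/
def legendreDerivFun (r k j : ℕ) (x : ℝ × ℝ) : ℝ :=
  (legendreON k).eval x.1 * (Polynomial.derivative^[r] (legendreON j)).eval x.2

theorem legendreDerivFun_memLp (r k j : ℕ) : MemLp (legendreDerivFun r k j) 2 measQ := by
  have hc : Continuous (legendreDerivFun r k j) := by
    unfold legendreDerivFun
    fun_prop
  have hK : IsCompact squareQ := isCompact_Icc.prod isCompact_Icc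
  have : IsFiniteMeasure measQ :=
    ⟨by simpa [measQ] using hK.measure_lt_top⟩
  obtain ⟨C, hC⟩ := hK.exists_bound_of_continuousOn hc.continuousOn
  refine MemLp.of_bound hc.aestronglyMeasurable C ?_
  exact (ae_restrict_iff' hK.measurableSet).2 (Filter.Eventually.of_forall hC)

/-- The element `φ_k(t) φ_j^{(r)}(τ)` of `L₂(Q)`. -/
def legendreDerivL2 (r k j : ℕ) : L2Q := (legendreDerivFun_memLp r k j).toLp _

/-- The Fourier-Legendre coefficient `⟨f, φ_{k,j}⟩`. -/
def fourierLegendre (f : L2Q) (q : ℕ × ℕ) : ℝ :=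
  ∫ x, f x * ((legendreON q.1).eval x.1 * (legendreON q.2).eval x.2) ∂measQ

/-- The norm `‖f‖_{s,μ} = (∑_{k,j} max(1,k)^{sμ₁} max(1,j)^{sμ₂} |⟨f, φ_{k,j}⟩|^s)^{1/s}`,
with the value `∞` where the series diverges. -/
def classNorm (s μ₁ μ₂ : ℝ) (f : L2Q) : ℝ≥0∞ :=
  (∑' q : ℕ × ℕ, ENNReal.ofReal
    ((max 1 q.1 : ℝ) ^ (s * μ₁) * (max 1 q.2 : ℝ) ^ (s * μ₂) *
      |fourierLegendre f q| ^ s)) ^ (1 / s)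

/-- The class (closed unit ball) of functions `L^μ_{s,2}`. -/
def functionClass (s μ₁ μ₂ : ℝ) : Set L2Q := {f | classNorm s μ₁ μ₂ f ≤ 1}

/-- The general term of the series for `f^{(0,r)}`; its indices are the lattice points
`(k,j)` with `j ≥ r`. -/
def derivTerm (r : ℕ) (f : L2Q) (q : {q : ℕ × ℕ // r ≤ q.2}) : L2Q :=
  fourierLegendre f q.1 • legendreDerivL2 r q.1.1 q.1.2

/-- The derivative `f^{(0,r)}`, the sum in `L₂(Q)` of its Fourier-Legendre series. -/
def partialDeriv (r : ℕ) (f : L2Q) : L2Q := ∑' q, derivTerm r f q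

/-- `IsPerturbation p δ f g`: the numbers `g` are a perturbation of the Fourier-Legendre
coefficients of `f` of level `δ` in the `ℓ_p` metric. -/
def IsPerturbation (p : ℝ≥0∞) (δ : ℝ) (f : L2Q) (g : ℕ × ℕ → ℝ) : Prop :=
  eLpNorm (fun q => fourierLegendre f q - g q) p Measure.count ≤ ENNReal.ofReal δ

/-- The worst-case error over the class, in the metric of `L₂(Q)`, of an algorithm `ψ` that
uses the perturbed coefficients with indices in `Ω`. -/
def algError (r : ℕ) (s μ₁ μ₂ : ℝ) (p : ℝ≥0∞) (δ : ℝ) (Ω : Finset (ℕ × ℕ))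
    (ψ : (Ω → ℝ) → L2Q) : ℝ≥0∞ :=
  ⨆ (f : L2Q) (_ : f ∈ functionClass s μ₁ μ₂) (g : ℕ × ℕ → ℝ) (_ : IsPerturbation p δ f g),
    ‖partialDeriv r f - ψ (fun q => g q)‖ₑ

/-- The minimal radius `R^{(0,r)}_{N,δ}(L^μ_{s,2}, L₂, ℓ_p)` of the Galerkin information. -/
def minRadius (r : ℕ) (s μ₁ μ₂ : ℝ) (p : ℝ≥0∞) (N : ℕ) (δ : ℝ) : ℝ≥0∞ :=
  ⨅ (Ω : Finset (ℕ × ℕ)) (_ : ∀ q ∈ Ω, r ≤ q.2) (_ : Ω.card ≤ N) (ψ : (Ω → ℝ) → L2Q),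
    algError r s μ₁ μ₂ p δ Ω ψ

/-- The hyperbolic cross `{(k,j) : k^γ j ≤ n, 0 ≤ k ≤ n^{1/γ}, r ≤ j ≤ n}` (for `γ ≥ 1`,
where `k ≤ n^{1/γ}` implies `k ≤ n`). -/
def hypCross (r n : ℕ) (γ : ℝ) : Finset (ℕ × ℕ) :=
  (Finset.range (n + 1) ×ˢ Finset.Icc r n).filter
    (fun q => (q.1 : ℝ) ^ γ * q.2 ≤ n ∧ (q.1 : ℝ) ≤ (n : ℝ) ^ (1 / γ))

/-- The truncation method `D^{(0,r)}_{n,γ}`. -/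
def truncMethod (r n : ℕ) (γ : ℝ) (y : hypCross r n γ → ℝ) : L2Q :=
  ∑ q : hypCross r n γ, y q • legendreDerivL2 r q.1.1 q.1.2

/-- The worst-case error of the truncation method `D^{(0,r)}_{n,γ}`. -/
def truncError (r : ℕ) (s μ₁ μ₂ : ℝ) (p : ℝ≥0∞) (δ : ℝ) (n : ℕ) (γ : ℝ) : ℝ≥0∞ :=
  algError r s μ₁ μ₂ p δ (hypCross r n γ) (truncMethod r n γ)

end

/-! Elements `φ_k φ_j^{(r)}` with the same `k` are not orthogonal, but different rows `k` are, and
each element has norm at most a constant times `j^{2r-1/2}`. The upper bounds use the triangle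
inequality inside a row and Pythagoras across rows (`norm_sum_legendreDerivL2_sq_le`).

Upper bound. The truncation error splits into a tail and a noise part. Outside the cross, row `k`
starts beyond `n/k^γ`, and Hölder against the class weights bounds its contribution by `k^{γa-μ₁}
n^{-a}` times the weighted `ℓ_s` norm of the row. Since `γa ≤ μ₁` and `s < 2`, the squares add up to
a multiple of `n^{-2a}` (`exists_norm_sum_tail_le`). Inside the cross, row `k` has at most `X = n
k^{-γ}` points, all with `j ≤ X`, so its noise is at most a multiple of `δ X^E` with `E = 2r + 1/2 -
1/p`, which is square summable in `k` (`exists_norm_sum_noise_le`). As `a + E = β`, the choice `n ≍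
δ^{-1/β}` balances the two. The cross has `O(n)` points for `γ > 1` but only the bound `O(n log n)`
is available for `γ = 1`; hence the logarithmic gap in b).

Lower bound. Exact data suffice: if the coefficients of `f` vanish on `Ω`, then `f` and `-f` give
the same information. In row `0`, at least `N` of `2N` even indices `j ≍ N` avoid `Ω`; `f` gets
equal coefficients of order `N^{-μ₂-1/s}` there. The crux is that the derivatives add up coherently.
Iterating `P_j' = ∑ (2m+1) P_m` shows that they all have large positive inner products with the same
low-degree `φ_l`, so Bessel's inequality gives a norm of order `N^{2r+1/2}`
(`le_norm_sum_legendreDerivL2_sq`), as large as the triangle inequality permits. The product is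
`N^{-a}`, whatever `δ` is. -/

/-! ### Legendre polynomials and the expansion of their derivatives -/

open Polynomial in
/-- The Legendre polynomial with the classical normalization `P_n(1) = 1`. -/
noncomputable def legendreP (n : ℕ) : ℝ[X] :=
  C ((2 ^ n * (n.factorial : ℝ))⁻¹) * derivative^[n] ((X ^ 2 - 1) ^ n)

open Polynomial in
theorem legendreON_eq (n : ℕ) : legendreON n = C (Real.sqrt (n + 1 / 2)) * legendreP n := by
  rw [legendreON, legendreP, C_mul, mul_assoc]

open Polynomial in
theorem legendreP_zero : legendreP 0 = 1 := by simp [legendreP]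

open Polynomial in
theorem derivative_legendreP_one : derivative (legendreP 1) = legendreP 0 := by
  simp [legendreP, ← C_mul, one_add_one_eq_two]

-- Rodrigues' formula yields this after differentiating `(x²-1)^{n+2}` twice and writing `x² =
-- (x²-1) + 1`.
open Polynomial in
theorem derivative_legendreP_add_two (n : ℕ) :
    derivative (legendreP (n + 2)) =
      derivative (legendreP n) + C (2 * n + 3 : ℝ) * legendreP (n + 1) := by
  have h : derivative (derivative ((X ^ 2 - 1 : ℝ[X]) ^ (n + 2))) =
      C (2 * (n + 2) * (2 * n + 3) : ℝ) * (X ^ 2 - 1) ^ (n + 1) +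
      C (4 * (n + 2) * (n + 1) : ℝ) * (X ^ 2 - 1) ^ n := by
    simp [derivative_pow, C_mul, C_add, C_ofNat]
    ring
  have h1 : derivative^[n + 2 + 1] ((X ^ 2 - 1 : ℝ[X]) ^ (n + 2)) =
      derivative^[n + 1] (C (2 * (n + 2) * (2 * n + 3) : ℝ) * (X ^ 2 - 1) ^ (n + 1) +
      C (4 * (n + 2) * (n + 1) : ℝ) * (X ^ 2 - 1) ^ n) := by
    rw [← h, ← Function.iterate_succ_apply, ← Function.iterate_succ_apply]
  rw [legendreP, derivative_C_mul, ← Function.iterate_succ_apply' derivative, h1,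
    iterate_map_add derivative,
    iterate_derivative_C_mul, iterate_derivative_C_mul, legendreP, legendreP, derivative_C_mul,
    ← Function.iterate_succ_apply' derivative, mul_add, ← mul_assoc, ← mul_assoc, ← mul_assoc,
    ← C_mul,
    ← C_mul, ← C_mul, add_comm]
  have e1 : (2 ^ (n + 2) * ((n + 2).factorial : ℝ))⁻¹ * (4 * (n + 2) * (n + 1)) =
      (2 ^ n * (n.factorial : ℝ))⁻¹ := by
    have : (n.factorial : ℝ) ≠ 0 := by positivity
    simp only [Nat.factorial_succ]
    push_cast
    field_simp
    ring
  have e2 : (2 ^ (n + 2) * ((n + 2).factorial : ℝ))⁻¹ * (2 * (n + 2) * (2 * n + 3)) =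
      (2 * n + 3) * (2 ^ (n + 1) * ((n + 1).factorial : ℝ))⁻¹ := by
    have : (n.factorial : ℝ) ≠ 0 := by positivity
    simp only [Nat.factorial_succ]
    push_cast
    field_simp
    ring
  rw [e1, e2]

-- The coefficients are positive, which excludes cancellation in the lower bound, and they sum to at
-- most `n²`, which drives the upper bound.
open Polynomial in
theorem derivative_legendreP (n : ℕ) :
    derivative (legendreP n) =
      ∑ m ∈ Finset.range n with Odd (n - m), C (2 * m + 1 : ℝ) * legendreP m := by
  induction n using Nat.twoStepInduction with
  | zero => simp [legendreP_zero]
  | one => 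
    rw [derivative_legendreP_one]
    simp [Finset.sum_filter]
  | more n ih _ =>
    rw [derivative_legendreP_add_two, ih, Finset.sum_filter, Finset.sum_filter,
      Finset.sum_range_succ, Finset.sum_range_succ]
    have : ∀ m ∈ Finset.range n, (if Odd (n + 2 - m) then C (2 * m + 1 : ℝ) * legendreP m else 0)
        = if Odd (n - m) then C (2 * m + 1 : ℝ) * legendreP m else 0 := by
      intro m hm
      rw [Finset.mem_range] at hm
      have : Odd (n + 2 - m) ↔ Odd (n - m) := by grind
      simp only [this]
    rw [Finset.sum_congr rfl this]
    have h1 : ¬ Odd (n + 2 - n) := by grind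
    have h2 : Odd (n + 2 - (n + 1)) := by grind
    rw [if_neg h1, if_pos h2]
    push_cast
    ring_nf

open Polynomial in
theorem natDegree_legendreP_le (n : ℕ) : (legendreP n).natDegree ≤ n := by
  refine (natDegree_C_mul_le _ _).trans ((natDegree_iterate_derivative _ _).trans ?_)
  have : ((X ^ 2 - 1 : ℝ[X]) ^ n).natDegree ≤ n * 2 := by
    refine natDegree_pow_le_of_le n ?_
    compute_degree
  omega

/-! ### Orthonormality -/

/-- The bilinear form `∫_{-1}^1 p q` on polynomials. -/
noncomputable def legendreForm (p q : Polynomial ℝ) : ℝ := ∫ x in (-1 : ℝ)..1, p.eval x * q.eval x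

theorem legendreForm_comm (p q : Polynomial ℝ) : legendreForm p q = legendreForm q p := by
  simp only [legendreForm, mul_comm]

theorem legendreForm_add_left (p q u : Polynomial ℝ) :
    legendreForm (p + q) u = legendreForm p u + legendreForm q u := by
  simp only [legendreForm, Polynomial.eval_add, add_mul]
  exact intervalIntegral.integral_add
    (Continuous.intervalIntegrable (by fun_prop) _ _)
    (Continuous.intervalIntegrable (by fun_prop) _ _)

theorem legendreForm_C_mul_left (c : ℝ) (p q : Polynomial ℝ) :
    legendreForm (Polynomial.C c * p) q = c * legendreForm p q := by
  simp [legendreForm, mul_assoc]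

theorem legendreForm_zero_left (q : Polynomial ℝ) : legendreForm 0 q = 0 := by
  simp [legendreForm]

theorem legendreForm_C_mul_right (c : ℝ) (p q : Polynomial ℝ) :
    legendreForm p (Polynomial.C c * q) = c * legendreForm p q := by
  rw [legendreForm_comm, legendreForm_C_mul_left, legendreForm_comm]

theorem legendreForm_sum_left {ι : Type*} (s : Finset ι) (p : ι → Polynomial ℝ)
    (q : Polynomial ℝ) :
    legendreForm (∑ i ∈ s, p i) q = ∑ i ∈ s, legendreForm (p i) q := by
  classical
  induction s using Finset.induction_on with
  | empty => simp [legendreForm_zero_left]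
  | insert i s hi ih => rw [Finset.sum_insert hi, Finset.sum_insert hi, legendreForm_add_left, ih]

theorem legendreForm_sum_right {ι : Type*} (s : Finset ι) (p : ι → Polynomial ℝ)
    (q : Polynomial ℝ) :
    legendreForm q (∑ i ∈ s, p i) = ∑ i ∈ s, legendreForm q (p i) := by
  rw [legendreForm_comm, legendreForm_sum_left]
  simp only [legendreForm_comm q]

open Polynomial in
theorem legendreForm_derivative_left {u q : ℝ[X]} (h1 : u.eval 1 = 0) (h2 : u.eval (-1) = 0) :
    legendreForm (derivative u) q = -legendreForm u (derivative q) := by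
  have := intervalIntegral.integral_mul_deriv_eq_deriv_mul (a := -1) (b := 1)
    (fun x _ => q.hasDerivAt x) (fun x _ => u.hasDerivAt x)
    (Continuous.intervalIntegrable (by fun_prop) _ _)
    (Continuous.intervalIntegrable (by fun_prop) _ _)
  rw [h1, h2] at this
  rw [legendreForm_comm, legendreForm_comm u]
  simpa [legendreForm] using this

open Polynomial in
theorem eval_iterate_derivative_eq_zero {n i : ℕ} (hi : i < n) {x : ℝ} (hx : x ^ 2 = 1) :
    (derivative^[i] ((X ^ 2 - 1 : ℝ[X]) ^ n)).eval x = 0 := by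
  obtain ⟨q, hq⟩ := pow_sub_dvd_iterate_derivative_pow (X ^ 2 - 1 : ℝ[X]) n i
  rw [hq, eval_mul, eval_pow]
  simp [hx, show n - i ≠ 0 by omega]

-- Repeated integration by parts; the boundary terms vanish because `±1` are zeros of order `n` of
-- `(x²-1)^n`.
open Polynomial in
theorem legendreForm_iterate_derivative {n i : ℕ} (hi : i ≤ n) (q : ℝ[X]) :
    legendreForm (derivative^[n] ((X ^ 2 - 1) ^ n)) q =
      (-1) ^ i * legendreForm (derivative^[n - i] ((X ^ 2 - 1) ^ n)) (derivative^[i] q) := by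
  induction i with
  | zero => simp
  | succ i ih =>
    rw [ih (by omega), show n - i = (n - (i + 1)) + 1 by omega, Function.iterate_succ_apply',
      legendreForm_derivative_left (eval_iterate_derivative_eq_zero (by omega) (by norm_num))
        (eval_iterate_derivative_eq_zero (by omega) (by norm_num)),
      ← Function.iterate_succ_apply' derivative]
    ring

open Polynomial in
theorem legendreForm_legendreP_eq_zero {n : ℕ} {q : ℝ[X]} (hq : q.natDegree < n) :
    legendreForm (legendreP n) q = 0 := by
  rw [legendreP, legendreForm_C_mul_left, legendreForm_iterate_derivative le_rfl,
    iterate_derivative_eq_zero hq, legendreForm_comm, legendreForm_zero_left]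
  simp

-- The derivative of `x(x²-1)^{n+1}`, which vanishes at `±1`, integrates to zero.
open Polynomial in
theorem legendreForm_pow_one_succ (n : ℕ) :
    (2 * n + 3) * legendreForm ((X ^ 2 - 1) ^ (n + 1)) 1 =
      -(2 * (n + 1)) * legendreForm ((X ^ 2 - 1) ^ n) 1 := by
  have h : derivative (X * (X ^ 2 - 1 : ℝ[X]) ^ (n + 1)) =
      C (2 * n + 3 : ℝ) * (X ^ 2 - 1) ^ (n + 1) + C (2 * (n + 1) : ℝ) * (X ^ 2 - 1) ^ n := by
    simp [derivative_pow, C_mul, C_add, C_ofNat]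
    ring
  have := legendreForm_derivative_left (u := X * (X ^ 2 - 1 : ℝ[X]) ^ (n + 1)) (q := 1)
    (by simp) (by simp)
  rw [h, derivative_one, legendreForm_comm _ 0, legendreForm_zero_left, legendreForm_add_left,
    legendreForm_C_mul_left, legendreForm_C_mul_left] at this
  linarith

open Polynomial in
theorem legendreForm_pow_one (n : ℕ) :
    legendreForm ((X ^ 2 - 1) ^ n) 1 * ((2 * n + 1) * ((2 * n).factorial : ℝ)) =
      2 * (-1) ^ n * (2 ^ n * (n.factorial : ℝ)) ^ 2 := by
  induction n with
  | zero => simp [legendreForm]; norm_num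
  | succ n ih =>
    have h := legendreForm_pow_one_succ n
    rw [show 2 * (n + 1) = 2 * n + 1 + 1 by ring, Nat.factorial_succ, Nat.factorial_succ,
      Nat.factorial_succ]
    push_cast
    calc _ = ((2 * n + 3) * legendreForm ((X ^ 2 - 1) ^ (n + 1)) 1) *
          ((2 * n + 1 + 1) * ((2 * n + 1) * ((2 * n).factorial : ℝ))) := by ring
      _ = -(2 * (n + 1)) * (2 * n + 1 + 1) * (legendreForm ((X ^ 2 - 1) ^ n) 1 *
          ((2 * n + 1) * ((2 * n).factorial : ℝ))) := by rw [h]; ring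
      _ = _ := by rw [ih]; ring

open Polynomial in
theorem iterate_derivative_two_mul_pow (n : ℕ) :
    derivative^[2 * n] ((X ^ 2 - 1 : ℝ[X]) ^ n) = C ((2 * n).factorial : ℝ) := by
  have hm : ((X ^ 2 - 1 : ℝ[X]) ^ n).Monic := by
    refine Monic.pow ?_ n
    monicity!
  have hd : ((X ^ 2 - 1 : ℝ[X]) ^ n).natDegree = 2 * n := by
    rw [natDegree_pow, show (X ^ 2 - 1 : ℝ[X]).natDegree = 2 by compute_degree!, mul_comm]
  have h0 : (derivative^[2 * n] ((X ^ 2 - 1 : ℝ[X]) ^ n)).natDegree = 0 := by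
    have := natDegree_iterate_derivative ((X ^ 2 - 1 : ℝ[X]) ^ n) (2 * n)
    omega
  rw [eq_C_of_natDegree_eq_zero h0, coeff_iterate_derivative, zero_add, Nat.descFactorial_self,
    ← hd, hm.coeff_natDegree]
  simp

open Polynomial in
theorem legendreForm_legendreP_self (n : ℕ) :
    legendreForm (legendreP n) (legendreP n) = 2 / (2 * n + 1) := by
  have h := legendreForm_pow_one n
  have h2 : legendreForm (derivative^[n] ((X ^ 2 - 1) ^ n)) (derivative^[n] ((X ^ 2 - 1) ^ n)) =
      (-1) ^ n * ((2 * n).factorial * legendreForm ((X ^ 2 - 1) ^ n) 1) := by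
    rw [legendreForm_iterate_derivative le_rfl, ← Function.iterate_add_apply, ← two_mul,
      iterate_derivative_two_mul_pow, ← mul_one (C _), legendreForm_C_mul_right]
    simp
  rw [legendreP, legendreForm_C_mul_left, legendreForm_C_mul_right, h2]
  have h3 : (0 : ℝ) < 2 * n + 1 := by positivity
  have h4 : (n.factorial : ℝ) ≠ 0 := by positivity
  have h5 : ((-1 : ℝ) ^ n) * (-1) ^ n = 1 := by rw [← mul_pow]; simp
  field_simp
  linear_combination (-1) ^ n * h + 2 * (2 ^ n * (n.factorial : ℝ)) ^ 2 * h5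

theorem legendreForm_legendreP (i j : ℕ) :
    legendreForm (legendreP i) (legendreP j) = if i = j then 2 / (2 * i + 1 : ℝ) else 0 := by
  split_ifs with h
  · subst h
    exact legendreForm_legendreP_self i
  rcases lt_or_gt_of_ne h with h | h
  · rw [legendreForm_comm]
    exact legendreForm_legendreP_eq_zero ((natDegree_legendreP_le i).trans_lt h)
  · exact legendreForm_legendreP_eq_zero ((natDegree_legendreP_le j).trans_lt h)

theorem legendreForm_legendreON (i j : ℕ) :
    legendreForm (legendreON i) (legendreON j) = if i = j then 1 else 0 := by
  rw [legendreON_eq, legendreON_eq, legendreForm_C_mul_left, legendreForm_C_mul_right,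
    legendreForm_legendreP]
  split_ifs with h
  · subst h
    rw [← mul_assoc, Real.mul_self_sqrt (by positivity)]
    field_simp
  · simp

/-! ### Inner products of derivatives with low-degree Legendre polynomials -/

open Polynomial in
theorem iterate_derivative_succ_legendreP (r j : ℕ) :
    derivative^[r + 1] (legendreP j) =
      ∑ m ∈ Finset.range j with Odd (j - m), C (2 * m + 1 : ℝ) * derivative^[r] (legendreP m) := by
  rw [Function.iterate_succ_apply, derivative_legendreP, iterate_derivative_sum]
  simp only [iterate_derivative_C_mul]

open Polynomial in
theorem legendreForm_iterate_derivative_succ (r j l : ℕ) :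
    legendreForm (derivative^[r + 1] (legendreP j)) (legendreP l) =
      ∑ m ∈ Finset.range j with Odd (j - m),
        (2 * m + 1 : ℝ) * legendreForm (derivative^[r] (legendreP m)) (legendreP l) := by
  rw [iterate_derivative_succ_legendreP, legendreForm_sum_left]
  simp only [legendreForm_C_mul_left]

open Polynomial in
theorem legendreForm_iterate_derivative_nonneg (r j l : ℕ) :
    0 ≤ legendreForm (derivative^[r] (legendreP j)) (legendreP l) := by
  induction r generalizing j with
  | zero =>
    rw [Function.iterate_zero, id, legendreForm_legendreP]
    split_ifs <;> positivity
  | succ r ih =>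
    rw [legendreForm_iterate_derivative_succ]
    exact Finset.sum_nonneg fun m _ => mul_nonneg (by positivity) (ih m)

-- Each further derivative gains a factor `(2t)²`: in the expansion, the block `[2t(r+1), 2t(r+2))`
-- contains `t` indices of the right parity, each with weight at least `4t`, and all other terms are
-- nonnegative. Outside the stated parity the inner product is zero.
open Polynomial in
theorem le_legendreForm_iterate_derivative (t r j l : ℕ) (hj : 2 * t * (r + 1) ≤ j)
    (hl : l < 2 * t) (hp : Odd (j + l + r)) :
    2 * (2 * t : ℝ) ^ (2 * r) ≤
      legendreForm (derivative^[r + 1] (legendreP j)) (legendreP l) := by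
  induction r generalizing j with
  | zero =>
    rw [legendreForm_iterate_derivative_succ]
    have hm : l ∈ (Finset.range j).filter (fun m => Odd (j - m)) := by
      simp only [Finset.mem_filter, Finset.mem_range]
      grind
    refine le_trans ?_ (Finset.single_le_sum (fun m _ => mul_nonneg (by positivity)
      (legendreForm_iterate_derivative_nonneg 0 m l)) hm)
    rw [Function.iterate_zero, id, legendreForm_legendreP, if_pos rfl]
    have : (0 : ℝ) < 2 * l + 1 := by positivity
    field_simp
    simp
  | succ r ih =>
    rw [legendreForm_iterate_derivative_succ]
    -- The remainder modulo `2` puts `e i` in the parity class that the induction hypothesis needs.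
    let e : ℕ → ℕ := fun i => 2 * t * (r + 1) + 2 * i + (l + r + 1) % 2
    have hinj : Function.Injective e := fun a b h => by simp only [e] at h; omega
    have hsub : (Finset.range t).image e ⊆ (Finset.range j).filter (fun m => Odd (j - m)) := by
      intro m hm
      obtain ⟨i, hi, rfl⟩ := Finset.mem_image.1 hm
      rw [Finset.mem_range] at hi
      simp only [Finset.mem_filter, Finset.mem_range, e]
      have h1 : 2 * t * (r + 1 + 1) = 2 * t * (r + 1) + 2 * t := by ring
      have h2 : 2 * t * (r + 1) = 2 * (t * (r + 1)) := by ring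
      rw [h1] at hj
      rw [h2] at hj ⊢
      grind
    refine le_trans ?_ (Finset.sum_le_sum_of_subset_of_nonneg hsub fun m _ _ =>
      mul_nonneg (by positivity) (legendreForm_iterate_derivative_nonneg _ m l))
    rw [Finset.sum_image hinj.injOn]
    have hterm : ∀ i ∈ Finset.range t, (4 * t : ℝ) * (2 * (2 * t : ℝ) ^ (2 * r)) ≤
        (2 * (e i : ℝ) + 1) *
          legendreForm (derivative^[r + 1] (legendreP (e i))) (legendreP l) := by
      intro i hi
      have hle : 2 * t * (r + 1) ≤ e i := by simp only [e]; omega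
      have hodd : Odd (e i + l + r) := by
        have h2 : 2 * t * (r + 1) = 2 * (t * (r + 1)) := by ring
        simp only [e, h2]
        grind
      refine mul_le_mul ?_ (ih (e i) hle hodd) (by positivity) (by positivity)
      have : 2 * t ≤ e i := le_trans (by nlinarith) hle
      have : (2 * t : ℝ) ≤ e i := by exact_mod_cast this
      linarith
    refine le_trans ?_ (Finset.card_nsmul_le_sum _ _ _ hterm)
    rw [Finset.card_range, nsmul_eq_mul]
    have : (0 : ℝ) ≤ (2 * t : ℝ) ^ (2 * r) * t ^ 2 := by positivity
    calc _ = 8 * ((2 * t : ℝ) ^ (2 * r) * t ^ 2) := by ring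
      _ = _ := by ring
      _ ≤ _ := le_rfl

/-! ### Product functions in `L₂(Q)` -/

theorem measQ_eq_prod :
    measQ = (volume.restrict (Set.Icc (-1 : ℝ) 1)).prod (volume.restrict (Set.Icc (-1 : ℝ) 1)) := by
  rw [Measure.prod_restrict]
  rfl

instance isFiniteMeasure_measQ : IsFiniteMeasure measQ :=
  ⟨by simpa [measQ] using
    (show IsCompact squareQ from isCompact_Icc.prod isCompact_Icc).measure_lt_top⟩

theorem tensor_memLp (p q : Polynomial ℝ) :
    MemLp (fun x : ℝ × ℝ => p.eval x.1 * q.eval x.2) 2 measQ := by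
  have hc : Continuous (fun x : ℝ × ℝ => p.eval x.1 * q.eval x.2) := by fun_prop
  have hK : IsCompact squareQ := isCompact_Icc.prod isCompact_Icc
  obtain ⟨C, hC⟩ := hK.exists_bound_of_continuousOn hc.continuousOn
  refine MemLp.of_bound hc.aestronglyMeasurable C ?_
  exact (ae_restrict_iff' hK.measurableSet).2 (Filter.Eventually.of_forall hC)

/-- The element `p(t) q(τ)` of `L₂(Q)`, as a linear map in `q`. -/
noncomputable def tensorL2 (p : Polynomial ℝ) : Polynomial ℝ →ₗ[ℝ] L2Q where
  toFun q := (tensor_memLp p q).toLp _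
  map_add' q u := by
    rw [← MemLp.toLp_add]
    congr 1
    ext x
    simp [mul_add]
  map_smul' c q := by
    rw [RingHom.id_apply, ← MemLp.toLp_const_smul]
    congr 1
    ext x
    simp
    ring

theorem coeFn_tensorL2 (p q : Polynomial ℝ) :
    tensorL2 p q =ᵐ[measQ] fun x => p.eval x.1 * q.eval x.2 :=
  MemLp.coeFn_toLp (tensor_memLp p q)

theorem legendreDerivL2_eq (r k j : ℕ) :
    legendreDerivL2 r k j =
      tensorL2 (legendreON k) (Polynomial.derivative^[r] (legendreON j)) := rfl

theorem inner_tensorL2 (p q p' q' : Polynomial ℝ) :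
    inner ℝ (tensorL2 p q) (tensorL2 p' q') = legendreForm p p' * legendreForm q q' := by
  have h : inner ℝ (tensorL2 p q) (tensorL2 p' q') =
      ∫ x, (p.eval x.1 * p'.eval x.1) * (q.eval x.2 * q'.eval x.2) ∂measQ := by
    rw [L2.inner_def]
    refine integral_congr_ae ?_
    filter_upwards [coeFn_tensorL2 p q, coeFn_tensorL2 p' q'] with x h1 h2
    rw [h1, h2]
    simp
    ring
  rw [h, measQ_eq_prod, integral_prod_mul (fun t => p.eval t * p'.eval t)
    (fun t => q.eval t * q'.eval t), legendreForm, legendreForm,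
    intervalIntegral.integral_of_le (by norm_num), intervalIntegral.integral_of_le (by norm_num),
    integral_Icc_eq_integral_Ioc, integral_Icc_eq_integral_Ioc]

theorem inner_legendreDerivL2_of_ne (r : ℕ) {k k' : ℕ} (h : k ≠ k') (j j' : ℕ) :
    inner ℝ (legendreDerivL2 r k j) (legendreDerivL2 r k' j') = 0 := by
  rw [legendreDerivL2_eq, legendreDerivL2_eq, inner_tensorL2, legendreForm_legendreON, if_neg h,
    zero_mul]

theorem fourierLegendre_eq_inner (f : L2Q) (q : ℕ × ℕ) :
    fourierLegendre f q = inner ℝ (legendreDerivL2 0 q.1 q.2) f := by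
  rw [fourierLegendre, L2.inner_def]
  refine integral_congr_ae ?_
  filter_upwards [coeFn_tensorL2 (legendreON q.1) (legendreON q.2)] with x h1
  rw [legendreDerivL2_eq, Function.iterate_zero, id, h1]
  simp

theorem orthonormal_legendreDerivL2_zero :
    Orthonormal ℝ (fun q : ℕ × ℕ => legendreDerivL2 0 q.1 q.2) := by
  classical
  rw [orthonormal_iff_ite]
  rintro ⟨k, j⟩ ⟨k', j'⟩
  simp only [legendreDerivL2_eq, Function.iterate_zero, id, inner_tensorL2,
    legendreForm_legendreON, Prod.mk.injEq]
  split_ifs <;> simp_all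

/-! ### Size of derivatives and of their sums -/

open Polynomial in
theorem legendreForm_derivative_legendreP_self_le (j : ℕ) :
    legendreForm (derivative (legendreP j)) (derivative (legendreP j)) ≤ 2 * (j : ℝ) ^ 2 := by
  rw [derivative_legendreP, legendreForm_sum_left]
  have h1 : ∀ i ∈ Finset.range j,
      legendreForm (C (2 * i + 1 : ℝ) * legendreP i)
        (∑ m ∈ Finset.range j with Odd (j - m), C (2 * m + 1 : ℝ) * legendreP m) ≤
        2 * (2 * i + 1) := by
    intro i _
    rw [legendreForm_C_mul_left, legendreForm_sum_right]
    simp only [legendreForm_C_mul_right, legendreForm_legendreP, mul_ite, mul_zero,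
      Finset.sum_ite_eq]
    have : (0 : ℝ) < 2 * i + 1 := by positivity
    split_ifs
    · exact le_of_eq (by field_simp)
    · positivity
  have h2 : ∀ n : ℕ, ∑ i ∈ Finset.range n, 2 * (2 * (i : ℝ) + 1) = 2 * (n : ℝ) ^ 2 := by
    intro n
    induction n with
    | zero => simp
    | succ n ih => rw [Finset.sum_range_succ, ih]; push_cast; ring
  rw [← h2 j, Finset.sum_filter]
  refine Finset.sum_le_sum fun i hi => ?_
  split_ifs
  · exact h1 i hi
  · positivity

-- Orthogonality is used for the first derivative, where the triangle inequality would lose a factor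
-- `√j`. From then on the triangle inequality with `∑ (2m+1) = j²` gives the right power.
open Polynomial in
theorem norm_tensorL2_iterate_derivative_legendreP_le (k r j : ℕ) :
    ‖tensorL2 (legendreON k) (derivative^[r + 1] (legendreP j))‖ ≤
      Real.sqrt 2 * (j : ℝ) ^ (2 * r + 1) := by
  induction r generalizing j with
  | zero =>
    refine le_of_sq_le_sq ?_ (by positivity)
    rw [← real_inner_self_eq_norm_sq, inner_tensorL2, legendreForm_legendreON, if_pos rfl, one_mul,
      mul_pow, Real.sq_sqrt (by norm_num)]
    simpa using legendreForm_derivative_legendreP_self_le j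
  | succ r ih =>
    have h2 : ∀ n : ℕ, ∑ i ∈ Finset.range n, (2 * (i : ℝ) + 1) = (n : ℝ) ^ 2 := by
      intro n
      induction n with
      | zero => simp
      | succ n ih => rw [Finset.sum_range_succ, ih]; push_cast; ring
    rw [iterate_derivative_succ_legendreP, map_sum]
    calc _ ≤ ∑ m ∈ Finset.range j with Odd (j - m),
          (2 * m + 1 : ℝ) * (Real.sqrt 2 * (j : ℝ) ^ (2 * r + 1)) := by
          refine norm_sum_le_of_le _ fun m hm => ?_
          have hmj : m ≤ j := (Finset.mem_range.1 (Finset.mem_filter.1 hm).1).le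
          rw [← smul_eq_C_mul, map_smul, norm_smul, Real.norm_of_nonneg (by positivity)]
          have : (m : ℝ) ≤ j := by exact_mod_cast hmj
          gcongr
          refine (ih m).trans ?_
          gcongr
      _ ≤ ∑ m ∈ Finset.range j, (2 * m + 1 : ℝ) * (Real.sqrt 2 * (j : ℝ) ^ (2 * r + 1)) :=
          Finset.sum_le_sum_of_subset_of_nonneg (Finset.filter_subset _ _)
            fun _ _ _ => by positivity
      _ = _ := by
          rw [← Finset.sum_mul, h2]
          ring

theorem norm_legendreDerivL2_le {r : ℕ} (hr : 1 ≤ r) (k j : ℕ) :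
    ‖legendreDerivL2 r k j‖ ≤ 2 * (max 1 j : ℝ) ^ (2 * r - 1 / 2 : ℝ) := by
  obtain ⟨r, rfl⟩ : ∃ i, r = i + 1 := ⟨r - 1, by omega⟩
  have hm : (1 : ℝ) ≤ max 1 (j : ℝ) := le_max_left _ _
  rw [legendreDerivL2_eq, legendreON_eq j, Polynomial.iterate_derivative_C_mul,
    ← Polynomial.smul_eq_C_mul, map_smul, norm_smul, Real.norm_of_nonneg (by positivity)]
  calc _ ≤ Real.sqrt (2 * max 1 (j : ℝ)) * (Real.sqrt 2 * (max 1 (j : ℝ)) ^ (2 * r + 1)) := by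
        gcongr
        · rcases Nat.eq_zero_or_pos j with rfl | hj
          · norm_num
          · have : (1 : ℝ) ≤ j := by exact_mod_cast hj
            have := le_max_right (1 : ℝ) j
            linarith
        · refine (norm_tensorL2_iterate_derivative_legendreP_le k r j).trans ?_
          gcongr
          exact le_max_right _ _
    _ = _ := by
        have h2 : (2 * ((r + 1 : ℕ) : ℝ) - 1 / 2 : ℝ) = 1 / 2 + ((2 * r + 1 : ℕ) : ℝ) := by
          push_cast
          ring
        rw [Real.sqrt_mul (by norm_num), h2, Real.rpow_add (by positivity), Real.rpow_natCast,
          Real.sqrt_eq_rpow (max 1 (j : ℝ))]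
        linear_combination ((max 1 (j : ℝ)) ^ (1 / 2 : ℝ) * (max 1 (j : ℝ)) ^ (2 * r + 1)) *
          (Real.mul_self_sqrt (show (0 : ℝ) ≤ 2 by norm_num))

theorem norm_sum_sq_of_pairwise_inner_eq_zero {E ι : Type*} [NormedAddCommGroup E]
    [InnerProductSpace ℝ E] (s : Finset ι) (g : ι → E)
    (h : ∀ i ∈ s, ∀ j ∈ s, i ≠ j → inner ℝ (g i) (g j) = 0) :
    ‖∑ i ∈ s, g i‖ ^ 2 = ∑ i ∈ s, ‖g i‖ ^ 2 := by
  rw [← real_inner_self_eq_norm_sq, sum_inner]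
  refine Finset.sum_congr rfl fun i hi => ?_
  rw [inner_sum, Finset.sum_eq_single i (fun j hj hji => h i hi j hj hji.symm)
    (fun hn => absurd hi hn), real_inner_self_eq_norm_sq]

theorem norm_sum_legendreDerivL2_sq_le {r : ℕ} (hr : 1 ≤ r) (S : Finset (ℕ × ℕ))
    (c : ℕ × ℕ → ℝ) :
    ‖∑ q ∈ S, c q • legendreDerivL2 r q.1 q.2‖ ^ 2 ≤
      4 * ∑ k ∈ S.image Prod.fst,
        (∑ q ∈ S with q.1 = k, (max 1 q.2 : ℝ) ^ (2 * r - 1 / 2 : ℝ) * |c q|) ^ 2 := by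
  rw [← Finset.sum_fiberwise_of_maps_to (fun q hq => Finset.mem_image_of_mem Prod.fst hq),
    norm_sum_sq_of_pairwise_inner_eq_zero, Finset.mul_sum]
  · refine Finset.sum_le_sum fun k _ => ?_
    calc _ ≤ (∑ q ∈ S with q.1 = k, 2 * ((max 1 q.2 : ℝ) ^ (2 * r - 1 / 2 : ℝ) * |c q|)) ^ 2 := by
          gcongr
          refine norm_sum_le_of_le _ fun q _ => ?_
          rw [norm_smul, Real.norm_eq_abs, mul_comm, ← mul_assoc]
          gcongr
          exact norm_legendreDerivL2_le hr _ _
      _ = _ := by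
          rw [← Finset.mul_sum]
          ring
  · intro k _ k' _ hk
    rw [sum_inner]
    refine Finset.sum_eq_zero fun q hq => ?_
    rw [inner_sum]
    refine Finset.sum_eq_zero fun q' hq' => ?_
    rw [Finset.mem_filter] at hq hq'
    rw [inner_smul_left, inner_smul_right, inner_legendreDerivL2_of_ne r (by grind)]
    simp

/-- The factors `√(l+1/2)` and `√j` come from the normalization of `φ_l` and `φ_j`. -/
theorem le_inner_legendreDerivL2 (t r j l : ℕ) (hj : 2 * t * (r + 1) ≤ j)
    (hl : l < 2 * t) (hp : Odd (j + l + r)) :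
    Real.sqrt (l + 1 / 2) * (Real.sqrt j * (2 * (2 * t : ℝ) ^ (2 * r))) ≤
      inner ℝ (legendreDerivL2 0 0 l) (legendreDerivL2 (r + 1) 0 j) := by
  rw [legendreDerivL2_eq, legendreDerivL2_eq, inner_tensorL2, legendreForm_legendreON, if_pos rfl,
    one_mul, Function.iterate_zero, id, legendreON_eq l, legendreON_eq j,
    Polynomial.iterate_derivative_C_mul, legendreForm_C_mul_left, legendreForm_C_mul_right,
    legendreForm_comm]
  gcongr
  · linarith
  · exact le_legendreForm_iterate_derivative t r j l hj hl hp

/-- Bessel's inequality against `t` functions `φ_l` with `l < 2t`. Every `j ∈ A` contributes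
positively to each inner product, so these are at least `t` times a single bound; fixing the parity
of `j` lets the same `l` serve all of `A`. -/
theorem le_norm_sum_legendreDerivL2_sq (r t : ℕ) (A : Finset ℕ) (hA : t ≤ A.card)
    (hj : ∀ j ∈ A, 2 * t * (r + 1) ≤ j ∧ Even j) :
    4 * (t : ℝ) ^ 5 * (2 * t : ℝ) ^ (4 * r) ≤
      ‖∑ j ∈ A, legendreDerivL2 (r + 1) 0 j‖ ^ 2 := by
  set g := ∑ j ∈ A, legendreDerivL2 (r + 1) 0 j
  -- With `j` even, this `l` makes `j + l + r` odd.
  let e : ℕ → ℕ × ℕ := fun i => (0, 2 * i + (r + 1) % 2)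
  have hinj : Function.Injective e := fun a b h => by simp only [e, Prod.mk.injEq] at h; omega
  have hB := (orthonormal_legendreDerivL2_zero.comp e hinj).sum_inner_products_le g
    (s := Finset.range t)
  refine le_trans ?_ hB
  have hterm : ∀ i ∈ Finset.range t,
      ((2 * i + 1 / 2 : ℝ)) * (8 * (t : ℝ) ^ 3 * (2 * t : ℝ) ^ (4 * r)) ≤
        ‖inner ℝ (((fun q : ℕ × ℕ => legendreDerivL2 0 q.1 q.2) ∘ e) i) g‖ ^ 2 := by
    intro i hi
    rw [Finset.mem_range] at hi
    have h1 : t * (Real.sqrt (2 * i + 1 / 2) * (Real.sqrt (2 * t) * (2 * (2 * t : ℝ) ^ (2 * r)))) ≤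
        inner ℝ (legendreDerivL2 0 0 (2 * i + (r + 1) % 2)) g := by
      rw [inner_sum]
      calc _ ≤ (A.card : ℝ) * (Real.sqrt (2 * i + 1 / 2) *
            (Real.sqrt (2 * t) * (2 * (2 * t : ℝ) ^ (2 * r)))) := by gcongr
        _ = ∑ j ∈ A, (Real.sqrt (2 * i + 1 / 2) *
            (Real.sqrt (2 * t) * (2 * (2 * t : ℝ) ^ (2 * r)))) := by simp
        _ ≤ _ := by
          refine Finset.sum_le_sum fun j hjA => ?_
          obtain ⟨h2, h3⟩ := hj j hjA
          refine le_trans ?_ (le_inner_legendreDerivL2 t r j _ h2 (by omega) (by grind))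
          have h4 : 2 * t ≤ j := le_trans (by nlinarith) h2
          have h5 : (2 * t : ℝ) ≤ j := by exact_mod_cast h4
          gcongr
          push_cast
          have : (0 : ℝ) ≤ (((r + 1) % 2 : ℕ) : ℝ) := by positivity
          linarith
    rw [Real.norm_eq_abs, sq_abs]
    refine le_trans (le_of_eq ?_) (pow_le_pow_left₀ (by positivity) h1 2)
    have h6 : ∀ x y z : ℝ, ((t : ℝ) * (x * (y * (2 * z)))) ^ 2 =
        4 * (t : ℝ) ^ 2 * x ^ 2 * y ^ 2 * z ^ 2 := by
      intro x y z
      ring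
    rw [h6, Real.sq_sqrt (by positivity), Real.sq_sqrt (by positivity), ← pow_mul]
    ring
  refine le_trans ?_ (Finset.sum_le_sum hterm)
  have h2 : ∀ n : ℕ, ∑ i ∈ Finset.range n, (2 * (i : ℝ) + 1 / 2) = (n : ℝ) ^ 2 - n / 2 := by
    intro n
    induction n with
    | zero => simp
    | succ n ih => rw [Finset.sum_range_succ, ih]; push_cast; ring
  rw [← Finset.sum_mul, h2]
  rcases Nat.eq_zero_or_pos t with rfl | ht
  · simp
  have ht1 : (1 : ℝ) ≤ t := by exact_mod_cast ht
  calc _ = (t : ℝ) ^ 2 / 2 * (8 * (t : ℝ) ^ 3 * (2 * t : ℝ) ^ (4 * r)) := by ring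
    _ ≤ _ := by
      gcongr
      nlinarith

/-! ### Power sums and Hölder estimates -/

/-- Prepares a telescoping sum. Bernoulli's inequality for `(1+1/j)^α` gives the bound with
`(j+1)^{-1-α}`, and `j + 1 ≤ 2j` costs the factor `2^{1+α}`. -/
theorem rpow_neg_one_sub_le_sub {α : ℝ} (hα : 0 < α) {j : ℕ} (hj : 1 ≤ j) :
    (j : ℝ) ^ (-1 - α) ≤
      2 ^ (1 + α) / α * ((j : ℝ) ^ (-α) - ((j + 1 : ℕ) : ℝ) ^ (-α)) := by
  have hj1 : (1 : ℝ) ≤ j := by exact_mod_cast hj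
  have hj0 : (0 : ℝ) < j := by linarith
  have hq : (0 : ℝ) < (j : ℝ) / (j + 1) := by positivity
  have h1 : 1 + α * (1 / (j + 1)) ≤ ((j : ℝ) / (j + 1)) ^ (-α) := by
    rw [Real.rpow_def_of_pos hq]
    have h2 := Real.log_le_sub_one_of_pos hq
    have h3 := Real.add_one_le_exp (Real.log ((j : ℝ) / (j + 1)) * -α)
    have h4 : (j : ℝ) / (j + 1) - 1 = -(1 / (j + 1)) := by field_simp; ring
    rw [h4] at h2
    nlinarith
  have h5 : (j : ℝ) ^ (-α) = ((j : ℝ) / (j + 1)) ^ (-α) * ((j : ℝ) + 1) ^ (-α) := by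
    rw [← Real.mul_rpow hq.le (by positivity)]
    congr 1
    field_simp
  have h6 : α * ((j : ℝ) + 1) ^ (-1 - α) ≤ (j : ℝ) ^ (-α) - ((j : ℝ) + 1) ^ (-α) := by
    have h7 : ((j : ℝ) + 1) ^ (-1 - α) = (1 / (j + 1)) * ((j : ℝ) + 1) ^ (-α) := by
      rw [sub_eq_add_neg, Real.rpow_add (by positivity), Real.rpow_neg_one, one_div]
    have h8 : (0 : ℝ) ≤ ((j : ℝ) + 1) ^ (-α) := by positivity
    rw [h5, h7]
    nlinarith
  have h9 : (2 * j : ℝ) ^ (-1 - α) ≤ ((j : ℝ) + 1) ^ (-1 - α) :=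
    Real.rpow_le_rpow_of_nonpos (by positivity) (by linarith) (by linarith)
  have h10 : (j : ℝ) ^ (-1 - α) = 2 ^ (1 + α) * (2 * j : ℝ) ^ (-1 - α) := by
    rw [Real.mul_rpow (by norm_num) hj0.le, ← mul_assoc, ← Real.rpow_add (by norm_num)]
    simp
  push_cast
  rw [h10, div_mul_eq_mul_div, le_div_iff₀ hα, mul_assoc]
  refine mul_le_mul_of_nonneg_left (le_trans ?_ h6) (by positivity)
  rw [mul_comm]
  gcongr

theorem sum_rpow_neg_one_sub_le {α : ℝ} (hα : 0 < α) {T : Finset ℕ} {J : ℝ} (hJ : 0 < J)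
    (hT : ∀ j ∈ T, 1 ≤ j ∧ J ≤ j) :
    ∑ j ∈ T, (j : ℝ) ^ (-1 - α) ≤ 2 ^ (1 + α) / α * J ^ (-α) := by
  have hK : 0 < 2 ^ (1 + α) / α := by positivity
  rcases T.eq_empty_or_nonempty with rfl | hne
  · simp only [Finset.sum_empty]
    positivity
  set m := T.min' hne
  have hm := hT m (T.min'_mem hne)
  have htel : ∀ n : ℕ, ∑ j ∈ Finset.Ico m (m + n), (j : ℝ) ^ (-1 - α) ≤
      2 ^ (1 + α) / α * ((m : ℝ) ^ (-α) - ((m + n : ℕ) : ℝ) ^ (-α)) := by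
    intro n
    induction n with
    | zero => simp
    | succ n ih =>
      rw [← add_assoc, Finset.sum_Ico_succ_top (by omega)]
      have := rpow_neg_one_sub_le_sub hα (j := m + n) (by omega)
      linarith
  have hsub : T ⊆ Finset.Ico m (m + (T.max' hne + 1)) := by
    intro j hj
    have h1 := T.min'_le j hj
    have h2 := T.le_max' j hj
    simp only [Finset.mem_Ico]
    omega
  calc _ ≤ _ := Finset.sum_le_sum_of_subset_of_nonneg hsub fun _ _ _ => by positivity
    _ ≤ _ := htel _
    _ ≤ 2 ^ (1 + α) / α * (m : ℝ) ^ (-α) := by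
      gcongr
      exact sub_le_self _ (by positivity)
    _ ≤ _ := by
      gcongr 2 ^ (1 + α) / α * ?_
      exact Real.rpow_le_rpow_of_nonpos hJ hm.2 (by linarith)

/-- Hölder with the exponent `q` conjugate to `s`: as `1 - 1/s = 1/q`, the weights contribute `∑
j^{-1-aq}`, of order `J^{-aq}`. The map `e` lets `T` be a row of lattice points. -/
theorem exists_sum_rpow_mul_le_tail {s a : ℝ} (hs : 1 ≤ s) (ha : 0 < a) :
    ∃ C > (0 : ℝ), ∀ (ι : Type) (T : Finset ι) (e : ι → ℕ) (J : ℝ) (x : ι → ℝ),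
      Set.InjOn e T → 0 < J → (∀ i ∈ T, 1 ≤ e i ∧ J ≤ e i) → (∀ i, 0 ≤ x i) →
        ∑ i ∈ T, (e i : ℝ) ^ (-(a + 1 - 1 / s)) * x i ≤
          C * J ^ (-a) * (∑ i ∈ T, x i ^ s) ^ (1 / s) := by
  -- For `s = 1` the conjugate exponent is infinite and the largest weight is taken out directly.
  rcases hs.eq_or_lt with rfl | hs
  · refine ⟨1, one_pos, fun ι T e J x he hJ hT hx => ?_⟩
    simp only [Real.rpow_one, div_one, one_mul]
    rw [Finset.mul_sum]
    refine Finset.sum_le_sum fun i hi => mul_le_mul_of_nonneg_right ?_ (hx i)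
    rw [show -(a + 1 - 1) = -a by ring]
    exact Real.rpow_le_rpow_of_nonpos hJ (hT i hi).2 (by linarith)
  · set q := s.conjExponent
    have hpq : s.HolderConjugate q := Real.HolderConjugate.conjExponent hs
    have hq0 : 0 < q := hpq.symm.pos
    have hinv : 1 / q = 1 - 1 / s := by
      have := hpq.inv_add_inv_eq_one
      rw [one_div, one_div]
      linarith
    refine ⟨(2 ^ (1 + a * q) / (a * q)) ^ (1 / q), by positivity, fun ι T e J x he hJ hT hx => ?_⟩
    have hH := Real.inner_le_Lp_mul_Lq_of_nonneg T hpq.symm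
      (f := fun i => (e i : ℝ) ^ (-(a + 1 - 1 / s))) (g := x)
      (fun i _ => by positivity) (fun i _ => hx i)
    refine hH.trans (mul_le_mul_of_nonneg_right ?_
      (Real.rpow_nonneg (Finset.sum_nonneg fun i _ => Real.rpow_nonneg (hx i) _) _))
    have h1 : ∑ i ∈ T, ((e i : ℝ) ^ (-(a + 1 - 1 / s))) ^ q =
        ∑ j ∈ T.image e, (j : ℝ) ^ (-1 - a * q) := by
      rw [Finset.sum_image he]
      refine Finset.sum_congr rfl fun i _ => ?_
      rw [← Real.rpow_mul (by positivity)]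
      congr 1
      rw [show a + 1 - 1 / s = a + 1 / q by rw [hinv]; ring]
      field_simp
      ring
    rw [h1]
    have h2 := sum_rpow_neg_one_sub_le (α := a * q) (by positivity) (T := T.image e) hJ
      (by simpa using hT)
    refine (Real.rpow_le_rpow (Finset.sum_nonneg fun _ _ => by positivity) h2
      (by positivity)).trans (le_of_eq ?_)
    rw [Real.mul_rpow (by positivity) (by positivity), ← Real.rpow_mul hJ.le]
    congr 2
    field_simp

/-- Hölder against the constant one. For `p = ∞` the expression `(p⁻¹).toReal` is `0`, so one
formula covers all `p`. -/
theorem sum_abs_le_of_isPerturbation {p : ℝ≥0∞} (hp : 1 ≤ p) {δ : ℝ} (hδ : 0 ≤ δ) {f : L2Q}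
    {g : ℕ × ℕ → ℝ} (h : IsPerturbation p δ f g) (T : Finset (ℕ × ℕ)) :
    ∑ q ∈ T, |fourierLegendre f q - g q| ≤ (T.card : ℝ) ^ (1 - (p⁻¹).toReal) * δ := by
  unfold IsPerturbation at h
  rcases eq_or_ne p ∞ with rfl | hpt
  · have h1 : ∀ q ∈ T, |fourierLegendre f q - g q| ≤ δ := by
      intro q _
      have := (enorm_le_eLpNorm_count (fun q => fourierLegendre f q - g q) q
        (p := ∞) (by simp)).trans h
      rw [Real.enorm_eq_ofReal_abs] at this
      exact (ENNReal.ofReal_le_ofReal_iff hδ).1 this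
    have := Finset.sum_le_card_nsmul T _ δ h1
    simpa using this
  · have hp0 : p ≠ 0 := (zero_lt_one.trans_le hp).ne'
    have hp1 : 1 ≤ p.toReal := by
      rw [← ENNReal.toReal_one]
      exact ENNReal.toReal_mono hpt hp
    have hpos : 0 < p.toReal := by linarith
    have h1 : ∑ q ∈ T, |fourierLegendre f q - g q| ^ p.toReal ≤ δ ^ p.toReal := by
      rw [eLpNorm_eq_lintegral_rpow_enorm_toReal hp0 hpt, lintegral_count, one_div,
        ENNReal.rpow_inv_le_iff hpos] at h
      have h2 := (ENNReal.sum_le_tsum T).trans h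
      simp only [Real.enorm_eq_ofReal_abs] at h2
      rw [ENNReal.ofReal_rpow_of_nonneg hδ hpos.le] at h2
      rw [← ENNReal.ofReal_le_ofReal_iff (by positivity),
        ENNReal.ofReal_sum_of_nonneg (fun _ _ => by positivity)]
      refine le_trans (le_of_eq ?_) h2
      refine Finset.sum_congr rfl fun q _ => ?_
      rw [ENNReal.ofReal_rpow_of_nonneg (abs_nonneg _) hpos.le]
    have h3 := (Real.rpow_sum_le_const_mul_sum_rpow T (fun q => fourierLegendre f q - g q)
      hp1).trans (mul_le_mul_of_nonneg_left h1 (by positivity))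
    have h4 : ((T.card : ℝ) ^ (1 - (p⁻¹).toReal) * δ) ^ p.toReal =
        (T.card : ℝ) ^ (p.toReal - 1) * δ ^ p.toReal := by
      rw [Real.mul_rpow (by positivity) hδ, ← Real.rpow_mul (by positivity), ENNReal.toReal_inv]
      congr 2
      field_simp
    rw [← h4] at h3
    exact (Real.rpow_le_rpow_iff (Finset.sum_nonneg fun _ _ => abs_nonneg _) (by positivity)
      hpos).1 h3

/-! ### Geometry and cardinality of the hyperbolic cross -/

theorem summable_max_one_rpow_neg {γ : ℝ} (hγ : 1 < γ) :
    Summable fun k : ℕ => (max 1 k : ℝ) ^ (-γ) := by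
  rw [← summable_nat_add_iff 1]
  refine ((summable_nat_add_iff 1).2 (Real.summable_nat_rpow.2 (neg_lt_neg hγ))).congr fun k => ?_
  rw [max_eq_right (by push_cast; linarith [(Nat.cast_nonneg k : (0 : ℝ) ≤ k)])]

theorem mul_max_one_rpow_le_of_mem_hypCross {r n : ℕ} {γ : ℝ} {q : ℕ × ℕ}
    (h : q ∈ hypCross r n γ) : (q.2 : ℝ) * (max 1 q.1 : ℝ) ^ γ ≤ n := by
  simp only [hypCross, Finset.mem_filter, Finset.mem_product, Finset.mem_Icc] at h
  rcases Nat.eq_zero_or_pos q.1 with h0 | h0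
  · rw [h0]
    simpa using h.1.2.2
  · have : (1 : ℝ) ≤ q.1 := by exact_mod_cast h0
    rw [max_eq_right this, mul_comm]
    exact h.2.1

theorem le_of_mem_hypCross {r n : ℕ} {γ : ℝ} {q : ℕ × ℕ} (h : q ∈ hypCross r n γ) : r ≤ q.2 := by
  simp only [hypCross, Finset.mem_filter, Finset.mem_product, Finset.mem_Icc] at h
  exact h.1.2.1

theorem lt_mul_max_one_rpow_of_notMem_hypCross {r n : ℕ} (hr : 1 ≤ r) {γ : ℝ} (hγ : 1 ≤ γ)
    {q : ℕ × ℕ} (hq : r ≤ q.2) (h : q ∉ hypCross r n γ) :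
    (n : ℝ) < q.2 * (max 1 q.1 : ℝ) ^ γ := by
  by_contra! hle
  apply h
  have h2 : (1 : ℝ) ≤ q.2 := by exact_mod_cast hr.trans hq
  have hm : (1 : ℝ) ≤ max 1 (q.1 : ℝ) := le_max_left _ _
  have hmγ : (1 : ℝ) ≤ (max 1 (q.1 : ℝ)) ^ γ := Real.one_le_rpow hm (by linarith)
  have hkm : (q.1 : ℝ) ≤ max 1 (q.1 : ℝ) := le_max_right _ _
  have hkγ : (max 1 (q.1 : ℝ)) ^ γ ≤ n := by nlinarith
  have h3 : (q.1 : ℝ) ^ γ ≤ (max 1 (q.1 : ℝ)) ^ γ := by gcongr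
  have h4 : max 1 (q.1 : ℝ) ≤ (max 1 (q.1 : ℝ)) ^ γ := by
    simpa using Real.rpow_le_rpow_of_exponent_le hm hγ
  simp only [hypCross, Finset.mem_filter, Finset.mem_product, Finset.mem_Icc, Finset.mem_range]
  refine ⟨⟨?_, hq, ?_⟩, ?_, ?_⟩
  · have : (q.1 : ℝ) ≤ n := by linarith
    have : q.1 ≤ n := by exact_mod_cast this
    omega
  · have : (q.2 : ℝ) ≤ n := by nlinarith
    exact_mod_cast this
  · nlinarith
  · rw [one_div, Real.le_rpow_inv_iff_of_pos (by positivity) (by positivity) (by linarith)]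
    linarith

theorem card_hypCross_filter_le {r n : ℕ} (hr : 1 ≤ r) (γ : ℝ) (k : ℕ) :
    (((hypCross r n γ).filter (fun q => q.1 = k)).card : ℝ) ≤ n * (max 1 k : ℝ) ^ (-γ) := by
  have hm : (0 : ℝ) < (max 1 (k : ℝ)) ^ γ := by positivity
  have h1 : ((hypCross r n γ).filter (fun q => q.1 = k)).card ≤
      (Finset.Icc 1 ⌊n * (max 1 k : ℝ) ^ (-γ)⌋₊).card := by
    refine Finset.card_le_card_of_injOn Prod.snd (fun q hq => ?_) (fun q hq q' hq' h => ?_)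
    · simp only [Finset.coe_filter, Set.mem_ofPred_eq] at hq
      have h2 := mul_max_one_rpow_le_of_mem_hypCross hq.1
      have h3 := le_of_mem_hypCross hq.1
      rw [hq.2] at h2
      simp only [Finset.coe_Icc, Set.mem_Icc]
      refine ⟨hr.trans h3, Nat.le_floor ?_⟩
      rwa [Real.rpow_neg (by positivity), ← div_eq_mul_inv, le_div_iff₀ hm]
    · simp only [Finset.coe_filter, Set.mem_ofPred_eq] at hq hq'
      exact Prod.ext (hq.2.trans hq'.2.symm) h
  rw [Nat.card_Icc, Nat.add_sub_cancel] at h1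
  exact (Nat.cast_le.2 h1).trans (Nat.floor_le (by positivity))

theorem card_hypCross_le_sum {r n : ℕ} (hr : 1 ≤ r) (γ : ℝ) :
    ((hypCross r n γ).card : ℝ) ≤ n * ∑ k ∈ Finset.range (n + 1), (max 1 k : ℝ) ^ (-γ) := by
  have h1 : ∀ q ∈ hypCross r n γ, q.1 ∈ Finset.range (n + 1) := by
    intro q hq
    simp only [hypCross, Finset.mem_filter, Finset.mem_product] at hq
    exact hq.1.1
  rw [Finset.card_eq_sum_card_fiberwise h1, Finset.mul_sum]
  push_cast
  exact Finset.sum_le_sum fun k _ => card_hypCross_filter_le hr γ k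

theorem exists_card_hypCross_le {γ : ℝ} (hγ : 1 < γ) :
    ∃ C > (0 : ℝ), ∀ r n : ℕ, 1 ≤ r → ((hypCross r n γ).card : ℝ) ≤ C * n := by
  have hs := summable_max_one_rpow_neg hγ
  refine ⟨∑' k : ℕ, (max 1 k : ℝ) ^ (-γ), hs.tsum_pos (fun _ => by positivity) 0 (by simp),
    fun r n hr => ?_⟩
  rw [mul_comm]
  refine (card_hypCross_le_sum hr γ).trans ?_
  gcongr
  exact hs.sum_le_tsum _ fun _ _ => by positivity

theorem card_hypCross_one_le {r n : ℕ} (hr : 1 ≤ r) :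
    ((hypCross r n 1).card : ℝ) ≤ n * (2 + Real.log n) := by
  refine (card_hypCross_le_sum hr 1).trans ?_
  gcongr
  have h1 := harmonic_le_one_add_log n
  rw [Finset.sum_range_succ']
  have h2 : ∑ k ∈ Finset.range n, (max 1 (k + 1 : ℕ) : ℝ) ^ (-1 : ℝ) = (harmonic n : ℝ) := by
    rw [harmonic]
    push_cast
    refine Finset.sum_congr rfl fun k _ => ?_
    rw [max_eq_right (by linarith [(Nat.cast_nonneg k : (0 : ℝ) ≤ k)]), Real.rpow_neg_one]
  rw [h2]
  simp
  linarith

/-! ### Upper bounds for the truncation method -/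

theorem sum_rpow_le_one_of_mem_functionClass {s μ₁ μ₂ : ℝ} (hs : 1 ≤ s) {f : L2Q}
    (hf : f ∈ functionClass s μ₁ μ₂) (T : Finset (ℕ × ℕ)) :
    ∑ q ∈ T, ((max 1 q.1 : ℝ) ^ μ₁ * (max 1 q.2 : ℝ) ^ μ₂ * |fourierLegendre f q|) ^ s ≤ 1 := by
  have hs0 : 0 < s := by linarith
  have h : classNorm s μ₁ μ₂ f ≤ 1 := hf
  rw [classNorm, one_div, ENNReal.rpow_inv_le_iff hs0, ENNReal.one_rpow] at h
  have h2 := (ENNReal.sum_le_tsum T).trans h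
  rw [← ENNReal.ofReal_sum_of_nonneg (fun _ _ => by positivity), ENNReal.ofReal_le_one] at h2
  refine le_trans (le_of_eq (Finset.sum_congr rfl fun q _ => ?_)) h2
  rw [Real.mul_rpow (by positivity) (by positivity), Real.mul_rpow (by positivity) (by positivity),
    ← Real.rpow_mul (by positivity), ← Real.rpow_mul (by positivity), mul_comm μ₁, mul_comm μ₂]

/-- The `ℓ_s` masses `F` of the rows have total at most one, and `F^{2/s} ≤ F`. Hence the rows can
be summed without any decay in `k` to spare, and `γa = μ₁` is allowed. -/
theorem exists_norm_sum_tail_le {r : ℕ} (hr : 1 ≤ r) {s μ₁ μ₂ a : ℝ} (hs₁ : 1 ≤ s) (hs₂ : s < 2)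
    (ha : a = μ₂ - 2 * r + 1 / s - 1 / 2) (ha0 : 0 < a) {γ : ℝ} (hγ : 1 ≤ γ)
    (hγμ : γ * a ≤ μ₁) :
    ∃ C > (0 : ℝ), ∀ n : ℕ, ∀ f ∈ functionClass s μ₁ μ₂, ∀ t : Finset (ℕ × ℕ),
      (∀ q ∈ t, r ≤ q.2 ∧ q ∉ hypCross r n γ) →
        ‖∑ q ∈ t, fourierLegendre f q • legendreDerivL2 r q.1 q.2‖ ≤
          C * (max 1 n : ℝ) ^ (-a) := by
  have hs0 : 0 < s := by linarith
  obtain ⟨C, hC, hT⟩ := exists_sum_rpow_mul_le_tail hs₁ ha0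
  refine ⟨2 * C, by positivity, fun n f hf t ht => ?_⟩
  refine le_of_sq_le_sq ((norm_sum_legendreDerivL2_sq_le hr t _).trans ?_) (by positivity)
  set x : ℕ × ℕ → ℝ := fun q =>
    (max 1 q.1 : ℝ) ^ μ₁ * (max 1 q.2 : ℝ) ^ μ₂ * |fourierLegendre f q|
  have hx : ∀ q, 0 ≤ x q := fun q => by positivity
  have hsum := sum_rpow_le_one_of_mem_functionClass hs₁ hf t
  have hM : (1 : ℝ) ≤ max 1 (n : ℝ) := le_max_left _ _
  have hrow : ∀ k ∈ t.image Prod.fst,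
      (∑ q ∈ t with q.1 = k, (max 1 q.2 : ℝ) ^ (2 * r - 1 / 2 : ℝ) * |fourierLegendre f q|) ^ 2 ≤
        (C * (max 1 n : ℝ) ^ (-a)) ^ 2 * ∑ q ∈ t with q.1 = k, x q ^ s := by
    intro k _
    set F := ∑ q ∈ t with q.1 = k, x q ^ s
    have hF0 : 0 ≤ F := Finset.sum_nonneg fun q _ => Real.rpow_nonneg (hx q) _
    have hF1 : F ≤ 1 := sum_rpow_le_one_of_mem_functionClass hs₁ hf _
    have hk : (1 : ℝ) ≤ max 1 (k : ℝ) := le_max_left _ _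
    have hkγ : (1 : ℝ) ≤ (max 1 (k : ℝ)) ^ γ := Real.one_le_rpow hk (by linarith)
    have h1 := hT (ℕ × ℕ) (t.filter fun q => q.1 = k) Prod.snd
      (max 1 (n : ℝ) / (max 1 (k : ℝ)) ^ γ) x
      (fun q hq q' hq' h => by
        simp only [Finset.coe_filter, Set.mem_ofPred_eq] at hq hq'
        exact Prod.ext (hq.2.trans hq'.2.symm) h)
      (by positivity)
      (fun q hq => by
        rw [Finset.mem_filter] at hq
        obtain ⟨h2, h3⟩ := ht q hq.1
        have h4 := lt_mul_max_one_rpow_of_notMem_hypCross hr hγ h2 h3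
        have h5 : (1 : ℝ) ≤ q.2 := by exact_mod_cast hr.trans h2
        rw [hq.2] at h4
        refine ⟨hr.trans h2, ?_⟩
        rw [div_le_iff₀ (by positivity)]
        exact max_le (by nlinarith) h4.le) hx
    have h2 : ∑ q ∈ t with q.1 = k,
        (max 1 q.2 : ℝ) ^ (2 * r - 1 / 2 : ℝ) * |fourierLegendre f q| =
        (max 1 (k : ℝ)) ^ (-μ₁) *
          ∑ q ∈ t with q.1 = k, (q.2 : ℝ) ^ (-(a + 1 - 1 / s)) * x q := by
      rw [Finset.mul_sum]
      refine Finset.sum_congr rfl fun q hq => ?_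
      rw [Finset.mem_filter] at hq
      have h5 : (1 : ℝ) ≤ q.2 := by exact_mod_cast hr.trans (ht q hq.1).1
      simp only [x]
      rw [max_eq_right h5, hq.2]
      have h6 : (2 * r - 1 / 2 : ℝ) = -(a + 1 - 1 / s) + μ₂ := by rw [ha]; ring
      have h7 : (max 1 (k : ℝ)) ^ (-μ₁) * (max 1 (k : ℝ)) ^ μ₁ = 1 := by
        rw [← Real.rpow_add (by positivity)]
        simp
      rw [h6, Real.rpow_add (by positivity)]
      linear_combination (-(q.2 : ℝ) ^ (-(a + 1 - 1 / s)) * (q.2 : ℝ) ^ μ₂ *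
        |fourierLegendre f q|) * h7
    have h3 : (max 1 (k : ℝ)) ^ (-μ₁) * (max 1 (n : ℝ) / (max 1 (k : ℝ)) ^ γ) ^ (-a) ≤
        (max 1 (n : ℝ)) ^ (-a) := by
      have h8 : (max 1 (k : ℝ)) ^ (-μ₁) * (max 1 (k : ℝ)) ^ (γ * a) ≤ 1 := by
        rw [← Real.rpow_add (by positivity)]
        exact Real.rpow_le_one_of_one_le_of_nonpos hk (by linarith)
      rw [Real.div_rpow (by positivity) (by positivity), ← Real.rpow_mul (by positivity), mul_neg,
        Real.rpow_neg (by positivity : (0 : ℝ) ≤ max 1 (k : ℝ)) (γ * a), div_inv_eq_mul]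
      have : 0 ≤ (max 1 (n : ℝ)) ^ (-a) := by positivity
      nlinarith
    -- This is where `s < 2` enters.
    have h4 : (F ^ (1 / s)) ^ 2 ≤ F := by
      rw [← Real.rpow_natCast, ← Real.rpow_mul hF0]
      refine Real.rpow_le_self_of_le_one hF0 hF1 ?_
      rw [div_mul_eq_mul_div, one_mul, le_div_iff₀ hs0]
      push_cast
      linarith
    calc _ ≤ (C * (max 1 (n : ℝ)) ^ (-a) * F ^ (1 / s)) ^ 2 := by
          refine pow_le_pow_left₀ (Finset.sum_nonneg fun _ _ => by positivity) ?_ 2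
          rw [h2]
          calc _ ≤ (max 1 (k : ℝ)) ^ (-μ₁) *
                (C * (max 1 (n : ℝ) / (max 1 (k : ℝ)) ^ γ) ^ (-a) * F ^ (1 / s)) :=
                mul_le_mul_of_nonneg_left h1 (by positivity)
            _ = C * ((max 1 (k : ℝ)) ^ (-μ₁) * (max 1 (n : ℝ) / (max 1 (k : ℝ)) ^ γ) ^ (-a)) *
                F ^ (1 / s) := by ring
            _ ≤ _ := by gcongr
      _ = (C * (max 1 (n : ℝ)) ^ (-a)) ^ 2 * (F ^ (1 / s)) ^ 2 := by ring
      _ ≤ _ := by gcongr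
  calc _ ≤ 4 * ∑ k ∈ t.image Prod.fst, (C * (max 1 n : ℝ) ^ (-a)) ^ 2 *
        ∑ q ∈ t with q.1 = k, x q ^ s := by
        gcongr with k hk
        exact hrow k hk
    _ = 4 * ((C * (max 1 n : ℝ) ^ (-a)) ^ 2 * ∑ q ∈ t, x q ^ s) := by
        rw [← Finset.mul_sum,
          Finset.sum_fiberwise_of_maps_to (fun q hq => Finset.mem_image_of_mem Prod.fst hq)]
    _ ≤ 4 * ((C * (max 1 n : ℝ) ^ (-a)) ^ 2 * 1) := by gcongr
    _ = _ := by ring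

/-- Since `E ≥ 1` and `γ ≥ 1`, the squared row bounds decay at least like `k^{-2}`, which makes the
constant independent of `n`, even for `γ = 1`. -/
theorem exists_norm_sum_noise_le {r : ℕ} (hr : 1 ≤ r) {p : ℝ≥0∞} (hp : 1 ≤ p) {γ : ℝ}
    (hγ : 1 ≤ γ) :
    ∃ C > (0 : ℝ), ∀ n : ℕ, ∀ δ : ℝ, 0 ≤ δ → ∀ (f : L2Q) (g : ℕ × ℕ → ℝ),
      IsPerturbation p δ f g →
        ‖∑ q ∈ hypCross r n γ, (fourierLegendre f q - g q) • legendreDerivL2 r q.1 q.2‖ ≤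
          C * (δ * (n : ℝ) ^ (2 * r + 1 / 2 - (p⁻¹).toReal)) := by
  have hZ := summable_max_one_rpow_neg (one_lt_two)
  set Z := ∑' k : ℕ, (max 1 k : ℝ) ^ (-2 : ℝ)
  have hZ0 : 0 < Z := hZ.tsum_pos (fun _ => by positivity) 0 (by simp)
  have hp1 : (p⁻¹).toReal ≤ 1 := by
    rw [← ENNReal.toReal_one]
    exact ENNReal.toReal_mono ENNReal.one_ne_top (ENNReal.inv_le_one.2 hp)
  have hr1 : (1 : ℝ) ≤ r := by exact_mod_cast hr
  refine ⟨2 * Real.sqrt Z, by positivity, fun n δ hδ f g h => ?_⟩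
  set E : ℝ := 2 * r + 1 / 2 - (p⁻¹).toReal
  refine le_of_sq_le_sq ((norm_sum_legendreDerivL2_sq_le hr _ _).trans ?_) (by positivity)
  have hrow : ∀ k ∈ (hypCross r n γ).image Prod.fst,
      (∑ q ∈ hypCross r n γ with q.1 = k,
        (max 1 q.2 : ℝ) ^ (2 * r - 1 / 2 : ℝ) * |fourierLegendre f q - g q|) ^ 2 ≤
        (δ * (n : ℝ) ^ E) ^ 2 * (max 1 k : ℝ) ^ (-2 : ℝ) := by
    intro k _
    have hk : (1 : ℝ) ≤ max 1 (k : ℝ) := le_max_left _ _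
    set X : ℝ := n * (max 1 (k : ℝ)) ^ (-γ)
    have hX : 0 ≤ X := by positivity
    have h1 : ∑ q ∈ hypCross r n γ with q.1 = k,
        (max 1 q.2 : ℝ) ^ (2 * r - 1 / 2 : ℝ) * |fourierLegendre f q - g q| ≤ X ^ E * δ := by
      calc _ ≤ ∑ q ∈ hypCross r n γ with q.1 = k,
            X ^ (2 * r - 1 / 2 : ℝ) * |fourierLegendre f q - g q| := by
            refine Finset.sum_le_sum fun q hq => ?_
            rw [Finset.mem_filter] at hq
            have h2 := mul_max_one_rpow_le_of_mem_hypCross hq.1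
            have h3 : (1 : ℝ) ≤ q.2 := by exact_mod_cast hr.trans (le_of_mem_hypCross hq.1)
            rw [hq.2] at h2
            have h4 : (q.2 : ℝ) ≤ X := by
              simp only [X]
              rwa [Real.rpow_neg (by positivity), ← div_eq_mul_inv, le_div_iff₀ (by positivity)]
            rw [max_eq_right h3]
            refine mul_le_mul_of_nonneg_right ?_ (abs_nonneg _)
            exact Real.rpow_le_rpow (by positivity) h4 (by linarith)
        _ ≤ X ^ (2 * r - 1 / 2 : ℝ) * (X ^ (1 - (p⁻¹).toReal) * δ) := by
            rw [← Finset.mul_sum]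
            refine mul_le_mul_of_nonneg_left ((sum_abs_le_of_isPerturbation hp hδ h _).trans ?_)
              (by positivity)
            refine mul_le_mul_of_nonneg_right ?_ hδ
            exact Real.rpow_le_rpow (by positivity) (card_hypCross_filter_le hr γ k) (by linarith)
        _ = _ := by
            rw [← mul_assoc, ← Real.rpow_add_of_nonneg hX (by linarith) (by linarith)]
            congr 2
            simp only [E]
            ring
    have h5 : (X ^ E) ^ 2 ≤ ((n : ℝ) ^ E) ^ 2 * (max 1 k : ℝ) ^ (-2 : ℝ) := by
      rw [Real.mul_rpow (by positivity) (by positivity), mul_pow]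
      refine mul_le_mul_of_nonneg_left ?_ (by positivity)
      rw [← Real.rpow_natCast, ← Real.rpow_mul (by positivity), ← Real.rpow_mul (by positivity)]
      refine Real.rpow_le_rpow_of_exponent_le hk ?_
      have : 1 ≤ E := by simp only [E]; linarith
      push_cast
      nlinarith
    calc _ ≤ (X ^ E * δ) ^ 2 :=
          pow_le_pow_left₀ (Finset.sum_nonneg fun _ _ => by positivity) h1 2
      _ = δ ^ 2 * (X ^ E) ^ 2 := by ring
      _ ≤ δ ^ 2 * (((n : ℝ) ^ E) ^ 2 * (max 1 k : ℝ) ^ (-2 : ℝ)) := by gcongr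
      _ = _ := by ring
  calc _ ≤ 4 * ∑ k ∈ (hypCross r n γ).image Prod.fst,
        (δ * (n : ℝ) ^ E) ^ 2 * (max 1 k : ℝ) ^ (-2 : ℝ) := by
        gcongr with k hk
        exact hrow k hk
    _ ≤ 4 * ((δ * (n : ℝ) ^ E) ^ 2 * Z) := by
        rw [← Finset.mul_sum]
        gcongr
        exact hZ.sum_le_tsum _ fun _ _ => by positivity
    _ = _ := by
        linear_combination (-4 * (δ * (n : ℝ) ^ E) ^ 2) * Real.sq_sqrt hZ0.le

theorem sum_derivTerm (r : ℕ) (f : L2Q) (t : Finset {q : ℕ × ℕ // r ≤ q.2}) :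
    ∑ q ∈ t, derivTerm r f q = ∑ q ∈ t.map (Function.Embedding.subtype _),
      fourierLegendre f q • legendreDerivL2 r q.1 q.2 := by
  rw [Finset.sum_map]
  rfl

/-- Cauchy's criterion: finite sums that avoid a large cross with `γ = 1` are small by the tail
estimate. -/
theorem summable_derivTerm {r : ℕ} (hr : 1 ≤ r) {s μ₁ μ₂ a : ℝ} (hs₁ : 1 ≤ s) (hs₂ : s < 2)
    (ha : a = μ₂ - 2 * r + 1 / s - 1 / 2) (ha0 : 0 < a) (hμ : a ≤ μ₁) {f : L2Q}
    (hf : f ∈ functionClass s μ₁ μ₂) : Summable (derivTerm r f) := by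
  obtain ⟨C, hC, hT⟩ := exists_norm_sum_tail_le (μ₁ := μ₁) hr hs₁ hs₂ ha ha0 le_rfl
    (by rwa [one_mul])
  rw [summable_iff_vanishing_norm]
  intro ε hε
  have hlim : Filter.Tendsto (fun n : ℕ => C * (max 1 n : ℝ) ^ (-a)) Filter.atTop (nhds 0) := by
    have h1 := ((tendsto_rpow_neg_atTop ha0).comp tendsto_natCast_atTop_atTop).const_mul C
    rw [mul_zero] at h1
    refine h1.congr' ?_
    filter_upwards [Filter.eventually_ge_atTop 1] with n hn
    have : (1 : ℝ) ≤ n := by exact_mod_cast hn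
    rw [max_eq_right this]
    rfl
  obtain ⟨n, hn⟩ := (hlim.eventually (gt_mem_nhds hε)).exists
  refine ⟨(hypCross r n 1).subtype _, fun t ht => ?_⟩
  rw [sum_derivTerm]
  refine (hT n f hf _ fun q hq => ?_).trans_lt hn
  obtain ⟨q', hq', rfl⟩ := Finset.mem_map.1 hq
  exact ⟨q'.2, fun h => Finset.disjoint_left.1 ht hq' (Finset.mem_subtype.2 h)⟩

theorem exists_truncError_le {r : ℕ} (hr : 1 ≤ r) {s μ₁ μ₂ a : ℝ} {p : ℝ≥0∞} (hp : 1 ≤ p)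
    (hs₁ : 1 ≤ s) (hs₂ : s < 2) (ha : a = μ₂ - 2 * r + 1 / s - 1 / 2) (ha0 : 0 < a)
    {γ : ℝ} (hγ : 1 ≤ γ) (hγμ : γ * a ≤ μ₁) :
    ∃ C > (0 : ℝ), ∀ n : ℕ, ∀ δ : ℝ, 0 ≤ δ →
      truncError r s μ₁ μ₂ p δ n γ ≤ ENNReal.ofReal
        (C * ((max 1 n : ℝ) ^ (-a) + δ * (n : ℝ) ^ (2 * r + 1 / 2 - (p⁻¹).toReal))) := by
  obtain ⟨C, hC, hT⟩ := exists_norm_sum_tail_le hr hs₁ hs₂ ha ha0 hγ hγμ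
  obtain ⟨C', hC', hN⟩ := exists_norm_sum_noise_le hr hp hγ
  refine ⟨max C C', lt_max_of_lt_left hC, fun n δ hδ => ?_⟩
  refine iSup₂_le fun f hf => iSup₂_le fun g hg => ?_
  rw [← ofReal_norm]
  refine ENNReal.ofReal_le_ofReal ?_
  have hsum := summable_derivTerm hr hs₁ hs₂ ha ha0 (by nlinarith) hf
  have h1 : ‖partialDeriv r f - ∑ q ∈ hypCross r n γ,
      fourierLegendre f q • legendreDerivL2 r q.1 q.2‖ ≤ C * (max 1 n : ℝ) ^ (-a) := by
    have htend := (hsum.hasSum.sub_const (∑ q ∈ hypCross r n γ,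
      fourierLegendre f q • legendreDerivL2 r q.1 q.2)).norm
    refine le_of_tendsto htend ?_
    filter_upwards [Filter.eventually_ge_atTop ((hypCross r n γ).subtype fun q => r ≤ q.2)]
      with t ht
    -- Once a partial sum contains the cross, its difference from the truncated sum is a finite
    -- tail.
    have hsub : hypCross r n γ ⊆ t.map (Function.Embedding.subtype _) := by
      intro q hq
      exact Finset.mem_map.2 ⟨⟨q, le_of_mem_hypCross hq⟩, ht (Finset.mem_subtype.2 hq), rfl⟩
    rw [sum_derivTerm, ← Finset.sum_sdiff_eq_sub hsub]
    refine hT n f hf _ fun q hq => ?_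
    rw [Finset.mem_sdiff] at hq
    obtain ⟨q', hq', rfl⟩ := Finset.mem_map.1 hq.1
    exact ⟨q'.2, hq.2⟩
  have h2 : truncMethod r n γ (fun q => g q) =
      ∑ q ∈ hypCross r n γ, g q • legendreDerivL2 r q.1 q.2 :=
    Finset.sum_coe_sort _ fun q : ℕ × ℕ => g q • legendreDerivL2 r q.1 q.2
  have h3 := hN n δ hδ f g hg
  simp only [sub_smul, Finset.sum_sub_distrib] at h3
  rw [h2]
  calc _ ≤ _ + _ := norm_sub_le_norm_sub_add_norm_sub _ _ _
    _ ≤ _ := add_le_add h1 h3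
    _ ≤ max C C' * (max 1 n : ℝ) ^ (-a) +
        max C C' * (δ * (n : ℝ) ^ (2 * r + 1 / 2 - (p⁻¹).toReal)) := by
        gcongr
        · exact le_max_left _ _
        · exact le_max_right _ _
    _ = _ := by ring

theorem minRadius_le_truncError {r : ℕ} {s μ₁ μ₂ : ℝ} {p : ℝ≥0∞} {δ : ℝ} {n N : ℕ} {γ : ℝ}
    (h : (hypCross r n γ).card ≤ N) :
    minRadius r s μ₁ μ₂ p N δ ≤ truncError r s μ₁ μ₂ p δ n γ :=
  iInf_le_of_le (hypCross r n γ) <| iInf_le_of_le (fun _ hq => le_of_mem_hypCross hq) <|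
    iInf_le_of_le h <| iInf_le_of_le (truncMethod r n γ) le_rfl

theorem rpow_neg_one_div_rpow {δ : ℝ} (hδ : 0 < δ) (β x : ℝ) :
    (δ ^ (-1 / β)) ^ x = δ ^ (-(x / β)) := by
  rw [← Real.rpow_mul hδ.le]
  congr 1
  ring

/-- The identity `a + E = β` turns both error terms into `δ^{a/β}`. The lower condition is on `max 1
n`, so that `n = 0`, the floor of a small number, is admitted. -/
theorem exists_truncError_le_rpow {r : ℕ} (hr : 1 ≤ r) {s μ₁ μ₂ a β : ℝ} {p : ℝ≥0∞} (hp : 1 ≤ p)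
    (hs₁ : 1 ≤ s) (hs₂ : s < 2) (ha : a = μ₂ - 2 * r + 1 / s - 1 / 2) (ha0 : 0 < a)
    (hβ : β = μ₂ - (p⁻¹).toReal + 1 / s) (hβ0 : 0 < β)
    {γ : ℝ} (hγ : 1 ≤ γ) (hγμ : γ * a ≤ μ₁) {c₁ c₂ : ℝ} (hc₁ : 0 < c₁) (hc₂ : 0 < c₂) :
    ∃ C > (0 : ℝ), ∀ δ : ℝ, 0 < δ → ∀ n : ℕ,
      c₁ * δ ^ (-1 / β) ≤ (max 1 n : ℝ) → n ≤ c₂ * δ ^ (-1 / β) →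
        truncError r s μ₁ μ₂ p δ n γ ≤ ENNReal.ofReal (C * δ ^ (a / β)) := by
  obtain ⟨C, hC, hT⟩ := exists_truncError_le (p := p) hr hp hs₁ hs₂ ha ha0 hγ hγμ
  set E : ℝ := 2 * r + 1 / 2 - (p⁻¹).toReal
  refine ⟨C * (c₁ ^ (-a) + c₂ ^ E), by positivity, fun δ hδ n h1 h2 =>
    (hT n δ hδ.le).trans (ENNReal.ofReal_le_ofReal ?_)⟩
  have hp1 : (p⁻¹).toReal ≤ 1 := by
    rw [← ENNReal.toReal_one]
    exact ENNReal.toReal_mono ENNReal.one_ne_top (ENNReal.inv_le_one.2 hp)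
  have hr1 : (1 : ℝ) ≤ r := by exact_mod_cast hr
  have hD : 0 < δ ^ (-1 / β) := by positivity
  have h3 : (max 1 n : ℝ) ^ (-a) ≤ c₁ ^ (-a) * δ ^ (a / β) := by
    refine (Real.rpow_le_rpow_of_nonpos (by positivity) h1 (by linarith)).trans (le_of_eq ?_)
    rw [Real.mul_rpow hc₁.le hD.le, rpow_neg_one_div_rpow hδ, neg_div, neg_neg]
  have h4 : δ * (n : ℝ) ^ E ≤ c₂ ^ E * δ ^ (a / β) := by
    have hE : 0 ≤ E := by simp only [E]; linarith
    have h5 : a / β = 1 + -(E / β) := by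
      field_simp
      simp only [ha, hβ, E]
      ring
    calc _ ≤ δ * (c₂ * δ ^ (-1 / β)) ^ E := by gcongr
      _ = _ := by
        rw [Real.mul_rpow hc₂.le hD.le, rpow_neg_one_div_rpow hδ, h5, Real.rpow_add hδ,
          Real.rpow_one]
        ring
  calc _ ≤ C * (c₁ ^ (-a) * δ ^ (a / β) + c₂ ^ E * δ ^ (a / β)) := by gcongr
    _ = _ := by ring

/-! ### Lower bound for the minimal radius -/

theorem fourierLegendre_neg (f : L2Q) (q : ℕ × ℕ) :
    fourierLegendre (-f) q = -fourierLegendre f q := by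
  rw [fourierLegendre_eq_inner, fourierLegendre_eq_inner, inner_neg_right]

theorem neg_mem_functionClass {s μ₁ μ₂ : ℝ} {f : L2Q} (hf : f ∈ functionClass s μ₁ μ₂) :
    -f ∈ functionClass s μ₁ μ₂ := by
  have h : classNorm s μ₁ μ₂ (-f) = classNorm s μ₁ μ₂ f := by
    simp only [classNorm, fourierLegendre_neg, abs_neg]
  exact h.trans_le hf

theorem partialDeriv_neg (r : ℕ) (f : L2Q) : partialDeriv r (-f) = -partialDeriv r f := by
  rw [partialDeriv, partialDeriv, ← tsum_neg]
  refine tsum_congr fun q => ?_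
  rw [derivTerm, derivTerm, fourierLegendre_neg, neg_smul]

theorem isPerturbation_self (p : ℝ≥0∞) (δ : ℝ) (f : L2Q) :
    IsPerturbation p δ f (fourierLegendre f) := by
  simp [IsPerturbation]

/-- An element of the class whose coefficients vanish on `Ω` cannot be told apart from its
negative, so that its derivative bounds every error from below. -/
theorem enorm_partialDeriv_le_algError {r : ℕ} {s μ₁ μ₂ : ℝ} {p : ℝ≥0∞} {δ : ℝ}
    {Ω : Finset (ℕ × ℕ)} {f : L2Q} (hf : f ∈ functionClass s μ₁ μ₂)
    (hΩ : ∀ q ∈ Ω, fourierLegendre f q = 0) (ψ : (Ω → ℝ) → L2Q) :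
    ‖partialDeriv r f‖ₑ ≤ algError r s μ₁ μ₂ p δ Ω ψ := by
  have key : ∀ f' ∈ functionClass s μ₁ μ₂, (∀ q ∈ Ω, fourierLegendre f' q = 0) →
      ‖partialDeriv r f' - ψ 0‖ₑ ≤ algError r s μ₁ μ₂ p δ Ω ψ := by
    intro f' hf' h0
    have h1 : (fun q : Ω => fourierLegendre f' q) = 0 := funext fun q => h0 q q.2
    have h2 : ‖partialDeriv r f' - ψ (fun q => fourierLegendre f' q)‖ₑ ≤
        algError r s μ₁ μ₂ p δ Ω ψ :=
      le_iSup₂_of_le f' hf' (le_iSup₂_of_le (fourierLegendre f') (isPerturbation_self p δ f')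
        le_rfl)
    rwa [h1] at h2
  have h1 := key f hf hΩ
  have h2 := key (-f) (neg_mem_functionClass hf)
    (fun q hq => by rw [fourierLegendre_neg, hΩ q hq, neg_zero])
  rw [partialDeriv_neg] at h2
  have h3 : 2 * ‖partialDeriv r f‖ ≤
      ‖partialDeriv r f - ψ 0‖ + ‖-partialDeriv r f - ψ 0‖ := by
    have h4 := norm_sub_le (partialDeriv r f - ψ 0) (-partialDeriv r f - ψ 0)
    rwa [show partialDeriv r f - ψ 0 - (-partialDeriv r f - ψ 0) = (2 : ℝ) • partialDeriv r f by
      rw [two_smul]; abel, norm_smul, Real.norm_of_nonneg (by norm_num)] at h4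
  rcases le_total ‖partialDeriv r f‖ ‖partialDeriv r f - ψ 0‖ with h | h
  · exact (enorm_le_iff_norm_le.2 h).trans h1
  · exact (enorm_le_iff_norm_le.2 (by linarith)).trans h2

theorem fourierLegendre_smul_sum (c : ℝ) (A : Finset ℕ) (q : ℕ × ℕ) :
    fourierLegendre (c • ∑ j ∈ A, legendreDerivL2 0 0 j) q =
      if q.1 = 0 ∧ q.2 ∈ A then c else 0 := by
  have h := orthonormal_iff_ite.1 orthonormal_legendreDerivL2_zero
  have h1 : ∀ j ∈ A, inner ℝ (legendreDerivL2 0 q.1 q.2) (legendreDerivL2 0 0 j) =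
      if q.2 = j then (if q.1 = 0 then (1 : ℝ) else 0) else 0 := by
    intro j _
    refine (h q (0, j)).trans ?_
    by_cases h1 : q.1 = 0 <;> by_cases h2 : q.2 = j <;> simp [Prod.ext_iff, h1, h2]
  rw [fourierLegendre_eq_inner, inner_smul_right, inner_sum, Finset.sum_congr rfl h1,
    Finset.sum_ite_eq]
  by_cases h2 : q.1 = 0 <;> by_cases h3 : q.2 ∈ A <;> simp [h2, h3]

theorem smul_sum_mem_functionClass {s μ₁ μ₂ c : ℝ} (hs : 1 ≤ s) (hc : 0 ≤ c) {A : Finset ℕ}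
    (h : ∑ j ∈ A, ((max 1 j : ℝ) ^ μ₂ * c) ^ s ≤ 1) :
    c • ∑ j ∈ A, legendreDerivL2 0 0 j ∈ functionClass s μ₁ μ₂ := by
  have hs0 : 0 < s := by linarith
  change classNorm s μ₁ μ₂ _ ≤ 1
  rw [classNorm, one_div, ENNReal.rpow_inv_le_iff hs0, ENNReal.one_rpow,
    tsum_eq_sum (s := A.map (Function.Embedding.sectR 0 ℕ)), Finset.sum_map,
    ← ENNReal.ofReal_sum_of_nonneg (fun _ _ => by positivity), ENNReal.ofReal_le_one]
  · refine le_trans (le_of_eq (Finset.sum_congr rfl fun j hj => ?_)) h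
    simp only [Function.Embedding.sectR_apply]
    rw [fourierLegendre_smul_sum, if_pos ⟨rfl, hj⟩, Real.mul_rpow (by positivity) hc,
      ← Real.rpow_mul (by positivity), abs_of_nonneg hc, mul_comm μ₂]
    simp
  · intro q hq
    rw [fourierLegendre_smul_sum, if_neg, abs_zero, Real.zero_rpow hs0.ne', mul_zero,
      ENNReal.ofReal_zero]
    rintro ⟨h1, h2⟩
    exact hq (Finset.mem_map.2 ⟨q.2, h2, Prod.ext h1.symm rfl⟩)

theorem partialDeriv_smul_sum (r : ℕ) (c : ℝ) {A : Finset ℕ} (hA : ∀ j ∈ A, r ≤ j) :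
    partialDeriv r (c • ∑ j ∈ A, legendreDerivL2 0 0 j) =
      c • ∑ j ∈ A, legendreDerivL2 r 0 j := by
  rw [partialDeriv, tsum_eq_sum
    (s := (A.map (Function.Embedding.sectR 0 ℕ)).subtype fun q => r ≤ q.2), sum_derivTerm,
    Finset.subtype_map, Finset.filter_true_of_mem, Finset.sum_map,
    (Finset.smul_sum : c • ∑ j ∈ A, legendreDerivL2 r 0 j = _)]
  · refine Finset.sum_congr rfl fun j hj => ?_
    simp only [Function.Embedding.sectR_apply]
    rw [fourierLegendre_smul_sum, if_pos ⟨rfl, hj⟩]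
  · intro q hq
    obtain ⟨j, hj, rfl⟩ := Finset.mem_map.1 hq
    exact hA j hj
  · intro q hq
    rw [derivTerm, fourierLegendre_smul_sum, if_neg, zero_smul]
    rintro ⟨h1, h2⟩
    exact hq (Finset.mem_subtype.2 (Finset.mem_map.2 ⟨q.1.2, h2, Prod.ext h1.symm rfl⟩))

/-- Of the `2N` candidates `2Nr + 2i`, at most `N` are lost to `Ω`. -/
theorem exists_even_indices_notMem {Ω : Finset (ℕ × ℕ)} {N : ℕ} (hΩ : Ω.card ≤ N) (r : ℕ) :
    ∃ A : Finset ℕ, N ≤ A.card ∧ A.card ≤ 2 * N ∧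
      ∀ j ∈ A, 2 * N * r ≤ j ∧ j ≤ 2 * N * (r + 2) ∧ Even j ∧ (0, j) ∉ Ω := by
  classical
  set A₀ := (Finset.range (2 * N)).image fun i => 2 * (N * r) + 2 * i
  have hA₀ : A₀.card = 2 * N := by
    rw [Finset.card_image_of_injective _ (fun a b h => by omega),
      Finset.card_range]
  refine ⟨A₀.filter fun j => (0, j) ∉ Ω, ?_, ?_, ?_⟩
  · have h1 := Finset.card_filter_add_card_filter_not (s := A₀) (fun j => (0, j) ∈ Ω)
    have h2 : (A₀.filter fun j => (0, j) ∈ Ω).card ≤ Ω.card :=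
      Finset.card_le_card_of_injOn (fun j => (0, j))
        (fun j hj => (Finset.mem_filter.1 hj).2) (fun a _ b _ h => (Prod.mk.inj h).2)
    omega
  · exact (Finset.card_filter_le _ _).trans hA₀.le
  · intro j hj
    obtain ⟨h1, h2⟩ := Finset.mem_filter.1 hj
    obtain ⟨i, hi, rfl⟩ := Finset.mem_image.1 h1
    rw [Finset.mem_range] at hi
    refine ⟨by nlinarith, by nlinarith, by grind, h2⟩

theorem exists_le_minRadius {r : ℕ} (hr : 1 ≤ r) {s μ₁ μ₂ a : ℝ} {p : ℝ≥0∞} (hs : 1 ≤ s)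
    (ha : a = μ₂ - 2 * r + 1 / s - 1 / 2) (hμ₂ : 0 < μ₂) :
    ∃ c > (0 : ℝ), ∀ N : ℕ, 1 ≤ N → ∀ δ : ℝ,
      ENNReal.ofReal (c * (N : ℝ) ^ (-a)) ≤ minRadius r s μ₁ μ₂ p N δ := by
  have hs0 : 0 < s := by linarith
  refine ⟨(2 * (r + 2) : ℝ) ^ (-μ₂) * 2 ^ (-(1 / s)), by positivity, fun N hN δ => ?_⟩
  refine le_iInf fun Ω => le_iInf fun _ => le_iInf fun hcard => le_iInf fun ψ => ?_
  obtain ⟨A, hA1, hA2, hA⟩ := exists_even_indices_notMem hcard r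
  have hN1 : (1 : ℝ) ≤ N := by exact_mod_cast hN
  have hN0 : (0 : ℝ) < N := by linarith
  -- The first factor offsets the largest weight on `A`; the second makes each of the at most `2N`
  -- terms of the class sum at most `1/(2N)`.
  set c : ℝ := (2 * N * (r + 2) : ℝ) ^ (-μ₂) * (2 * N : ℝ) ^ (-(1 / s))
  have hc : 0 ≤ c := by positivity
  have hcl : c • ∑ j ∈ A, legendreDerivL2 0 0 j ∈ functionClass s μ₁ μ₂ := by
    refine smul_sum_mem_functionClass hs hc ?_
    have hterm : ∀ j ∈ A, ((max 1 j : ℝ) ^ μ₂ * c) ^ s ≤ (2 * N : ℝ)⁻¹ := by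
      intro j hj
      have h1 : (j : ℝ) ≤ 2 * N * (r + 2) := by exact_mod_cast (hA j hj).2.1
      have h2 : (max 1 j : ℝ) ≤ 2 * N * (r + 2) := by
        refine max_le ?_ h1
        have : (0 : ℝ) ≤ r := by positivity
        nlinarith
      have h3 : (max 1 j : ℝ) ^ μ₂ * (2 * N * (r + 2) : ℝ) ^ (-μ₂) ≤ 1 := by
        rw [Real.rpow_neg (by positivity), ← div_eq_mul_inv, div_le_one (by positivity)]
        gcongr
      calc _ ≤ ((2 * N : ℝ) ^ (-(1 / s))) ^ s := by
            refine Real.rpow_le_rpow (by positivity) ?_ hs0.le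
            rw [← mul_assoc]
            exact mul_le_of_le_one_left (by positivity) h3
        _ = _ := by
            rw [← Real.rpow_mul (by positivity), neg_mul, one_div_mul_cancel hs0.ne',
              Real.rpow_neg_one]
    refine (Finset.sum_le_card_nsmul _ _ _ hterm).trans ?_
    rw [nsmul_eq_mul, ← div_eq_mul_inv, div_le_one (by positivity)]
    exact_mod_cast hA2
  have hrA : ∀ j ∈ A, r ≤ j := fun j hj => le_trans (by nlinarith) (hA j hj).1
  refine le_trans ?_ (enorm_partialDeriv_le_algError hcl (fun q hq => ?_) ψ)
  · rw [partialDeriv_smul_sum r c hrA, ← ofReal_norm, norm_smul, Real.norm_of_nonneg hc]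
    refine ENNReal.ofReal_le_ofReal ?_
    have h1 : (N : ℝ) ^ (2 * r + 1 / 2 : ℝ) ≤ ‖∑ j ∈ A, legendreDerivL2 r 0 j‖ := by
      obtain ⟨r, rfl⟩ : ∃ i, r = i + 1 := ⟨r - 1, by omega⟩
      refine le_of_sq_le_sq (le_trans ?_ (le_norm_sum_legendreDerivL2_sq r N A hA1
        fun j hj => ⟨(hA j hj).1, (hA j hj).2.2.1⟩)) (norm_nonneg _)
      rw [← Real.rpow_natCast, ← Real.rpow_mul hN0.le]
      have h2 : ((2 * ((r + 1 : ℕ) : ℝ) + 1 / 2) * ((2 : ℕ) : ℝ)) = ((5 + 4 * r : ℕ) : ℝ) := by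
        push_cast
        ring
      rw [h2, Real.rpow_natCast, pow_add]
      gcongr
      · linarith [pow_pos hN0 5]
      · linarith
    refine le_trans (le_of_eq ?_) (mul_le_mul_of_nonneg_left h1 hc)
    simp only [c]
    have h2 : (N : ℝ) ^ (-a) =
        (N : ℝ) ^ (-μ₂) * (N : ℝ) ^ (-(1 / s)) * (N : ℝ) ^ (2 * r + 1 / 2 : ℝ) := by
      rw [← Real.rpow_add hN0, ← Real.rpow_add hN0, ha]
      congr 1
      ring
    rw [h2, show (2 * N * (r + 2) : ℝ) = 2 * (r + 2) * N by ring,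
      Real.mul_rpow (by positivity) hN0.le, Real.mul_rpow (by norm_num) hN0.le]
    ring
  · rw [fourierLegendre_smul_sum, if_neg]
    rintro ⟨h1, h2⟩
    exact (hA q.2 h2).2.2.2 (by rwa [← h1])

/-! ### Passing between `n`, `N` and `δ` -/

theorem rpow_div_le_of_le_mul {δ β a K x : ℝ} (hδ : 0 < δ) (ha : 0 < a) (hK : 0 < K) (hx : 0 < x)
    (h : x ≤ K * δ ^ (-1 / β)) : δ ^ (a / β) ≤ K ^ a * x ^ (-a) := by
  have hD : 0 < δ ^ (-1 / β) := by positivity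
  have h1 := Real.rpow_le_rpow_of_nonpos hx h (show -a ≤ 0 by linarith)
  rw [Real.mul_rpow hK.le hD.le, rpow_neg_one_div_rpow hδ, neg_div, neg_neg,
    Real.rpow_neg hK.le] at h1
  have hKa : 0 < K ^ a := by positivity
  rwa [inv_mul_le_iff₀ hKa] at h1

theorem half_mul_le_max_one_floor (x : ℝ) : 1 / 2 * x ≤ max 1 (⌊x⌋₊ : ℝ) := by
  have h := Nat.lt_floor_add_one x
  rcases le_total x 2 with h2 | h2
  · exact le_max_of_le_left (by linarith)
  · exact le_max_of_le_right (by linarith)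

theorem half_mul_le_floor {x : ℝ} (hx : 2 ≤ x) : 1 / 2 * x ≤ (⌊x⌋₊ : ℝ) := by
  have h := Nat.lt_floor_add_one x
  linarith

theorem le_rpow_neg_one_div {δ β M : ℝ} (hδ : 0 < δ) (hβ : 0 < β) (hM : 0 < M)
    (h : δ < M ^ (-β)) : M ≤ δ ^ (-1 / β) := by
  have h1 := Real.rpow_le_rpow_of_nonpos hδ h.le
    (show -1 / β ≤ 0 from div_nonpos_of_nonpos_of_nonneg (by norm_num) hβ.le)
  rwa [← Real.rpow_mul hM.le, show -β * (-1 / β) = 1 by field_simp, Real.rpow_one] at h1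

theorem log_rpow_neg_one_div {δ : ℝ} (hδ : 0 < δ) (β : ℝ) :
    Real.log (δ ^ (-1 / β)) = Real.log (1 / δ) / β := by
  rw [Real.log_rpow hδ, one_div, Real.log_inv]
  ring

theorem exists_floor_truncation_of_one_lt {r : ℕ} (hr : 1 ≤ r) {s μ₁ μ₂ a β : ℝ} {p : ℝ≥0∞}
    (hp : 1 ≤ p) (hs₁ : 1 ≤ s) (hs₂ : s < 2) (ha : a = μ₂ - 2 * r + 1 / s - 1 / 2) (ha0 : 0 < a)
    (hβ : β = μ₂ - (p⁻¹).toReal + 1 / s) (hβ0 : 0 < β)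
    {γ : ℝ} (hγ : 1 < γ) (hγμ : γ * a ≤ μ₁) {c₁ c₂ : ℝ} (hc₁ : 0 < c₁) (hc₂ : 0 < c₂) :
    ∃ ε > (0 : ℝ), ∃ C > (0 : ℝ), ∀ δ : ℝ, 0 < δ → ∀ N : ℕ,
      c₁ * δ ^ (-1 / β) ≤ N → N ≤ c₂ * δ ^ (-1 / β) →
        (hypCross r ⌊ε * δ ^ (-1 / β)⌋₊ γ).card ≤ N ∧
        truncError r s μ₁ μ₂ p δ ⌊ε * δ ^ (-1 / β)⌋₊ γ ≤ ENNReal.ofReal (C * (N : ℝ) ^ (-a)) ∧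
        truncError r s μ₁ μ₂ p δ ⌊ε * δ ^ (-1 / β)⌋₊ γ ≤ ENNReal.ofReal (C * δ ^ (a / β)) := by
  obtain ⟨K, hK, hcard⟩ := exists_card_hypCross_le hγ
  -- With `n ≤ (c₁/K) δ^{-1/β}` the bound `K n` for the size of the cross is at most `N`.
  have hε : 0 < c₁ / K := by positivity
  obtain ⟨C, hC, hT⟩ := exists_truncError_le_rpow hr hp hs₁ hs₂ ha ha0 hβ hβ0 hγ.le hγμ
    (half_pos hε) hε
  refine ⟨c₁ / K, hε, max C (C * c₂ ^ a), lt_max_of_lt_left hC, fun δ hδ N h1 h2 => ?_⟩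
  have hD : 0 < δ ^ (-1 / β) := by positivity
  have hN : (0 : ℝ) < N := lt_of_lt_of_le (by positivity) h1
  have hfl := Nat.floor_le (show 0 ≤ c₁ / K * δ ^ (-1 / β) by positivity)
  have h3 := hT δ hδ ⌊c₁ / K * δ ^ (-1 / β)⌋₊
    ((le_of_eq (by ring)).trans (half_mul_le_max_one_floor _)) hfl
  refine ⟨?_, h3.trans (ENNReal.ofReal_le_ofReal ?_), h3.trans (ENNReal.ofReal_le_ofReal ?_)⟩
  · have h4 : ((hypCross r ⌊c₁ / K * δ ^ (-1 / β)⌋₊ γ).card : ℝ) ≤ N :=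
      calc _ ≤ _ := hcard r _ hr
        _ ≤ K * (c₁ / K * δ ^ (-1 / β)) := by gcongr
        _ = c₁ * δ ^ (-1 / β) := by field_simp
        _ ≤ N := h1
    exact_mod_cast h4
  · calc _ ≤ C * (c₂ ^ a * (N : ℝ) ^ (-a)) := by
          gcongr
          exact rpow_div_le_of_le_mul hδ ha0 hc₂ hN h2
      _ = C * c₂ ^ a * (N : ℝ) ^ (-a) := by ring
      _ ≤ _ := by
          gcongr
          exact le_max_right _ _
  · gcongr
    exact le_max_left _ _

/-- As `δ → 1` the logarithm vanishes while `δ^{-1/β}` stays bounded, which contradicts `N ≥ 2`.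
This keeps the estimates of b) uniform up to `δ = 1`. -/
theorem exists_le_log_of_two_le {β c₂ : ℝ} (hβ : 0 < β) (hc₂ : 0 < c₂) :
    ∃ l > (0 : ℝ), ∀ δ : ℝ, 0 < δ →
      2 ≤ c₂ * (δ ^ (-1 / β) * Real.log (1 / δ)) → l ≤ Real.log (1 / δ) := by
  refine ⟨min 1 (2 / (c₂ * Real.exp (1 / β))), by positivity, fun δ hδ h => ?_⟩
  rcases le_total 1 (Real.log (1 / δ)) with h1 | h1
  · exact min_le_of_left_le h1
  · refine min_le_of_right_le ?_
    have hD : 0 < δ ^ (-1 / β) := by positivity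
    have hD1 : δ ^ (-1 / β) ≤ Real.exp (1 / β) := by
      rw [← Real.log_le_iff_le_exp hD, log_rpow_neg_one_div hδ]
      gcongr
    have hL : 0 < Real.log (1 / δ) := by
      by_contra! hn
      have := mul_nonpos_of_nonneg_of_nonpos hD.le hn
      nlinarith
    rw [div_le_iff₀ (by positivity)]
    calc _ ≤ _ := h
      _ ≤ c₂ * (Real.exp (1 / β) * Real.log (1 / δ)) := by gcongr
      _ = _ := by ring

/-- If `c₁ log(1/δ) ≤ 1`, then `N` is `O(δ^{-1/β})` and `log N ≥ log 2`. Otherwise `N ≥ δ^{-1/β}`,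
so `log N ≥ log(1/δ)/β` cancels the logarithm in `N`. -/
theorem exists_div_log_le {β c₁ c₂ : ℝ} (hβ : 0 < β) (hc₁ : 0 < c₁) (hc₂ : 0 < c₂) :
    ∃ K > (0 : ℝ), ∀ δ : ℝ, 0 < δ → ∀ N : ℕ, 2 ≤ N →
      c₁ * (δ ^ (-1 / β) * Real.log (1 / δ)) ≤ N →
      N ≤ c₂ * (δ ^ (-1 / β) * Real.log (1 / δ)) →
        N / Real.log N ≤ K * δ ^ (-1 / β) := by
  have hlog2 : 0 < Real.log 2 := Real.log_pos (by norm_num)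
  refine ⟨max (c₂ / c₁ / Real.log 2) (c₂ * β), by positivity, fun δ hδ N hN h1 h2 => ?_⟩
  have hD : 0 < δ ^ (-1 / β) := by positivity
  have hN2 : (2 : ℝ) ≤ N := by exact_mod_cast hN
  have hlogN : Real.log 2 ≤ Real.log N := Real.log_le_log (by norm_num) hN2
  have hL : 0 < Real.log (1 / δ) := by
    by_contra! hn
    have := mul_nonpos_of_nonneg_of_nonpos hD.le hn
    nlinarith
  rcases le_total (c₁ * Real.log (1 / δ)) 1 with h3 | h3
  · calc (N : ℝ) / Real.log N ≤ c₂ * (δ ^ (-1 / β) * (1 / c₁)) / Real.log 2 := by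
          gcongr
          refine h2.trans ?_
          gcongr
          rwa [le_div_iff₀ hc₁, mul_comm]
      _ = c₂ / c₁ / Real.log 2 * δ ^ (-1 / β) := by ring
      _ ≤ _ := by
          gcongr
          exact le_max_left _ _
  · have h4 : δ ^ (-1 / β) ≤ N := by nlinarith
    have h5 : Real.log (1 / δ) / β ≤ Real.log N := by
      rw [← log_rpow_neg_one_div hδ]
      exact Real.log_le_log hD h4
    calc (N : ℝ) / Real.log N ≤
          c₂ * (δ ^ (-1 / β) * Real.log (1 / δ)) / (Real.log (1 / δ) / β) := by gcongr
      _ = c₂ * β * δ ^ (-1 / β) := by field_simp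
      _ ≤ _ := by
          gcongr
          exact le_max_right _ _

theorem exists_floor_truncation_one {r : ℕ} (hr : 1 ≤ r) {s μ₁ μ₂ a β : ℝ} {p : ℝ≥0∞}
    (hp : 1 ≤ p) (hs₁ : 1 ≤ s) (hs₂ : s < 2) (ha : a = μ₂ - 2 * r + 1 / s - 1 / 2) (ha0 : 0 < a)
    (hβ : β = μ₂ - (p⁻¹).toReal + 1 / s) (hβ0 : 0 < β)
    (hμ : a ≤ μ₁) {c₁ c₂ : ℝ} (hc₁ : 0 < c₁) (hc₂ : 0 < c₂) :
    ∃ ε > (0 : ℝ), ∃ C > (0 : ℝ), ∀ δ : ℝ, 0 < δ → δ < 1 → ∀ N : ℕ, 2 ≤ N →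
      c₁ * (δ ^ (-1 / β) * Real.log (1 / δ)) ≤ N →
      N ≤ c₂ * (δ ^ (-1 / β) * Real.log (1 / δ)) →
        (hypCross r ⌊ε * δ ^ (-1 / β)⌋₊ 1).card ≤ N ∧
        truncError r s μ₁ μ₂ p δ ⌊ε * δ ^ (-1 / β)⌋₊ 1 ≤
          ENNReal.ofReal (C * (N / Real.log N) ^ (-a)) ∧
        truncError r s μ₁ μ₂ p δ ⌊ε * δ ^ (-1 / β)⌋₊ 1 ≤
          ENNReal.ofReal (C * δ ^ (a / β)) := by
  obtain ⟨l, hl, hlog⟩ := exists_le_log_of_two_le hβ0 hc₂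
  obtain ⟨K, hK, hdiv⟩ := exists_div_log_le hβ0 hc₁ hc₂
  -- The bound `ε ≤ 1` gives `log n ≤ log(1/δ)/β`; the other bound makes the cross fit into `N`
  -- points, with `l` absorbing the summand `2` of `2 + log n`.
  set ε := min 1 (c₁ / (2 / l + 1 / β))
  have hε : 0 < ε := by positivity
  obtain ⟨C, hC, hT⟩ := exists_truncError_le_rpow (μ₁ := μ₁) hr hp hs₁ hs₂ ha ha0 hβ hβ0 le_rfl
    (by rwa [one_mul]) (half_pos hε) hε
  refine ⟨ε, hε, max C (C * K ^ a), lt_max_of_lt_left hC, fun δ hδ hδ1 N hN h1 h2 => ?_⟩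
  have hD : 0 < δ ^ (-1 / β) := by positivity
  have hN2 : (2 : ℝ) ≤ N := by exact_mod_cast hN
  have hL := hlog δ hδ (hN2.trans h2)
  have hL0 : 0 < Real.log (1 / δ) := hl.trans_le hL
  have hfl := Nat.floor_le (show 0 ≤ ε * δ ^ (-1 / β) by positivity)
  set n := ⌊ε * δ ^ (-1 / β)⌋₊
  have h3 := hT δ hδ n ((le_of_eq (by ring)).trans (half_mul_le_max_one_floor _)) hfl
  refine ⟨?_, h3.trans (ENNReal.ofReal_le_ofReal ?_), h3.trans (ENNReal.ofReal_le_ofReal ?_)⟩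
  · have hlogn : Real.log n ≤ Real.log (1 / δ) / β := by
      rcases Nat.eq_zero_or_pos n with h0 | h0
      · rw [h0, Nat.cast_zero, Real.log_zero]
        positivity
      · rw [← log_rpow_neg_one_div hδ]
        refine Real.log_le_log (by exact_mod_cast h0) (hfl.trans ?_)
        exact mul_le_of_le_one_left hD.le (min_le_left _ _)
    have h5 : 2 + Real.log (1 / δ) / β ≤ (2 / l + 1 / β) * Real.log (1 / δ) := by
      have : 2 ≤ 2 / l * Real.log (1 / δ) := by
        rw [div_mul_eq_mul_div, le_div_iff₀ hl]
        gcongr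
      rw [add_mul, one_div_mul_eq_div]
      gcongr
    have h6 : ε * (2 / l + 1 / β) ≤ c₁ := by
      rw [← le_div_iff₀ (by positivity)]
      exact min_le_right _ _
    have h4 : ((hypCross r n 1).card : ℝ) ≤ N :=
      calc _ ≤ _ := card_hypCross_one_le hr
        _ ≤ (ε * δ ^ (-1 / β)) * (2 + Real.log (1 / δ) / β) := by
            have : 0 ≤ Real.log (n : ℝ) := Real.log_natCast_nonneg n
            gcongr
        _ ≤ (ε * δ ^ (-1 / β)) * ((2 / l + 1 / β) * Real.log (1 / δ)) := by gcongr
        _ = ε * (2 / l + 1 / β) * (δ ^ (-1 / β) * Real.log (1 / δ)) := by ring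
        _ ≤ c₁ * (δ ^ (-1 / β) * Real.log (1 / δ)) := by gcongr
        _ ≤ N := h1
    exact_mod_cast h4
  · have hlogN : 0 < Real.log N := Real.log_pos (by linarith)
    have hq : 0 < (N : ℝ) / Real.log N := by positivity
    calc _ ≤ C * (K ^ a * (N / Real.log N : ℝ) ^ (-a)) := by
          gcongr
          exact rpow_div_le_of_le_mul hδ ha0 hK hq (hdiv δ hδ N hN h1 h2)
      _ = C * K ^ a * (N / Real.log N : ℝ) ^ (-a) := by ring
      _ ≤ _ := by
          gcongr
          exact le_max_right _ _
  · gcongr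
    exact le_max_left _ _

/-- The method cannot beat the minimal radius for as many points as its cross has, and for `γ > 1`
that number is `O(n)`. -/
theorem exists_le_truncError {r : ℕ} (hr : 1 ≤ r) {s μ₁ μ₂ a β : ℝ} {p : ℝ≥0∞}
    (hs₁ : 1 ≤ s) (ha : a = μ₂ - 2 * r + 1 / s - 1 / 2) (ha0 : 0 < a) (hμ₂ : 0 < μ₂)
    {γ : ℝ} (hγ : 1 < γ) {c₂ : ℝ} (hc₂ : 0 < c₂) :
    ∃ C > (0 : ℝ), ∀ δ : ℝ, 0 < δ → ∀ n : ℕ, 1 ≤ n → n ≤ c₂ * δ ^ (-1 / β) →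
      ENNReal.ofReal (C * δ ^ (a / β)) ≤ truncError r s μ₁ μ₂ p δ n γ := by
  obtain ⟨K, hK, hcard⟩ := exists_card_hypCross_le hγ
  obtain ⟨c, hc, hR⟩ := exists_le_minRadius (μ₁ := μ₁) (p := p) hr hs₁ ha hμ₂
  have hM : 0 < max 1 K * c₂ := by positivity
  refine ⟨c / (max 1 K * c₂) ^ a, by positivity, fun δ hδ n hn h => ?_⟩
  -- The cross is empty when `n < r`, whereas the radius bound needs `N ≥ 1`.
  refine le_trans ?_ ((hR (max 1 (hypCross r n γ).card) (le_max_left _ _) δ).trans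
    (minRadius_le_truncError (le_max_right _ _)))
  refine ENNReal.ofReal_le_ofReal ?_
  have hn1 : (1 : ℝ) ≤ n := by exact_mod_cast hn
  have h1 : ((max 1 (hypCross r n γ).card : ℕ) : ℝ) ≤ max 1 K * c₂ * δ ^ (-1 / β) := by
    rw [Nat.cast_max, Nat.cast_one, mul_assoc]
    refine le_trans (max_le ?_ ((hcard r n hr).trans ?_))
      (mul_le_mul_of_nonneg_left h (by positivity))
    · exact one_le_mul_of_one_le_of_one_le (le_max_left _ _) hn1
    · gcongr
      exact le_max_right _ _
  have h2 := rpow_div_le_of_le_mul hδ ha0 hM (by positivity) h1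
  rw [div_mul_eq_mul_div, div_le_iff₀ (by positivity)]
  calc _ ≤ _ := mul_le_mul_of_nonneg_left h2 hc.le
    _ = _ := by ring

/-! ### Assembly of the theorem -/

theorem mainTheorem11 (r : ℕ) (hr : 1 ≤ r) (s μ₁ μ₂ : ℝ) (p : ℝ≥0∞)
    (hs₁ : 1 ≤ s) (hs₂ : s < 2) (hp : 1 ≤ p)
    (hμ₂ : μ₂ > 2 * r - 1 / s + 1 / 2)
    (hμ₁ : μ₁ ≥ μ₂ - 2 * r + 1 / s - 1 / 2)
    (a β : ℝ) (ha : a = μ₂ - 2 * r + 1 / s - 1 / 2)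
    (hβ : β = μ₂ - (p⁻¹).toReal + 1 / s) :
    -- the series that defines the derivative converges in `L₂(Q)` on the whole class
    (∀ f ∈ functionClass s μ₁ μ₂, Summable (derivTerm r f)) ∧
    -- part a)
    (a < μ₁ → ∀ c₁ c₂ : ℝ, 0 < c₁ → c₁ ≤ c₂ →
      (∃ C₁ > (0 : ℝ), ∃ C₂ > (0 : ℝ), ∀ δ : ℝ, 0 < δ → δ < 1 → ∀ N : ℕ, 1 ≤ N →
        c₁ * δ ^ (-1 / β) ≤ N → N ≤ c₂ * δ ^ (-1 / β) →
          ENNReal.ofReal (C₁ * (N : ℝ) ^ (-a)) ≤ minRadius r s μ₁ μ₂ p N δ ∧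
          minRadius r s μ₁ μ₂ p N δ ≤ ENNReal.ofReal (C₂ * (N : ℝ) ^ (-a)) ∧
          ENNReal.ofReal (C₁ * δ ^ (a / β)) ≤ minRadius r s μ₁ μ₂ p N δ ∧
          minRadius r s μ₁ μ₂ p N δ ≤ ENNReal.ofReal (C₂ * δ ^ (a / β))) ∧
      ∀ γ : ℝ, 1 < γ → γ ≤ μ₁ / a →
        (∃ C₁ > (0 : ℝ), ∃ C₂ > (0 : ℝ), ∀ δ : ℝ, 0 < δ → δ < 1 → ∀ n : ℕ,
          c₁ * δ ^ (-1 / β) ≤ n → n ≤ c₂ * δ ^ (-1 / β) →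
            ENNReal.ofReal (C₁ * δ ^ (a / β)) ≤ truncError r s μ₁ μ₂ p δ n γ ∧
            truncError r s μ₁ μ₂ p δ n γ ≤ ENNReal.ofReal (C₂ * δ ^ (a / β))) ∧
        (∃ d₁ > (0 : ℝ), ∃ d₂ > (0 : ℝ), ∃ C > (0 : ℝ), ∃ δ₀ > (0 : ℝ),
          ∀ δ : ℝ, 0 < δ → δ < 1 → δ < δ₀ → ∀ N : ℕ,
            c₁ * δ ^ (-1 / β) ≤ N → N ≤ c₂ * δ ^ (-1 / β) →
              ∃ n : ℕ, d₁ * δ ^ (-1 / β) ≤ n ∧ n ≤ d₂ * δ ^ (-1 / β) ∧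
                (hypCross r n γ).card ≤ N ∧
                truncError r s μ₁ μ₂ p δ n γ ≤ ENNReal.ofReal (C * (N : ℝ) ^ (-a)) ∧
                truncError r s μ₁ μ₂ p δ n γ ≤ ENNReal.ofReal (C * δ ^ (a / β)))) ∧
    -- part b)
    (∀ c₁ c₂ : ℝ, 0 < c₁ → c₁ ≤ c₂ →
      (∃ C₁ > (0 : ℝ), ∃ C₂ > (0 : ℝ), ∀ δ : ℝ, 0 < δ → δ < 1 → ∀ N : ℕ, 2 ≤ N →
        c₁ * (δ ^ (-1 / β) * Real.log (1 / δ)) ≤ N →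
        N ≤ c₂ * (δ ^ (-1 / β) * Real.log (1 / δ)) →
          ENNReal.ofReal (C₁ * (N : ℝ) ^ (-a)) ≤ minRadius r s μ₁ μ₂ p N δ ∧
          minRadius r s μ₁ μ₂ p N δ ≤ ENNReal.ofReal (C₂ * (N / Real.log N) ^ (-a)) ∧
          ENNReal.ofReal (C₁ * (δ ^ (a / β) * Real.log (1 / δ) ^ (-a))) ≤
            minRadius r s μ₁ μ₂ p N δ ∧
          minRadius r s μ₁ μ₂ p N δ ≤ ENNReal.ofReal (C₂ * δ ^ (a / β))) ∧
      (∃ C > (0 : ℝ), ∀ δ : ℝ, 0 < δ → δ < 1 → ∀ n : ℕ,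
        c₁ * δ ^ (-1 / β) ≤ n → n ≤ c₂ * δ ^ (-1 / β) →
          truncError r s μ₁ μ₂ p δ n 1 ≤ ENNReal.ofReal (C * δ ^ (a / β))) ∧
      (∃ d₁ > (0 : ℝ), ∃ d₂ > (0 : ℝ), ∃ C > (0 : ℝ), ∃ δ₀ > (0 : ℝ),
        ∀ δ : ℝ, 0 < δ → δ < 1 → δ < δ₀ → ∀ N : ℕ,
          c₁ * (δ ^ (-1 / β) * Real.log (1 / δ)) ≤ N →
          N ≤ c₂ * (δ ^ (-1 / β) * Real.log (1 / δ)) →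
            ∃ n : ℕ, d₁ * δ ^ (-1 / β) ≤ n ∧ n ≤ d₂ * δ ^ (-1 / β) ∧
              (hypCross r n 1).card ≤ N ∧
              truncError r s μ₁ μ₂ p δ n 1 ≤
                ENNReal.ofReal (C * (N / Real.log N) ^ (-a)) ∧
              truncError r s μ₁ μ₂ p δ n 1 ≤ ENNReal.ofReal (C * δ ^ (a / β)))) := by
  have hs0 : 0 < s := by linarith
  have hsinv : 1 / s ≤ 1 := by rw [div_le_one hs0]; exact hs₁
  have hr1 : (1 : ℝ) ≤ r := by exact_mod_cast hr
  have ha0 : 0 < a := by rw [ha]; linarith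
  have hp1 : (p⁻¹).toReal ≤ 1 := by
    rw [← ENNReal.toReal_one]
    exact ENNReal.toReal_mono ENNReal.one_ne_top (ENNReal.inv_le_one.2 hp)
  have hβ0 : 0 < β := by rw [hβ]; linarith
  have hμ₂0 : 0 < μ₂ := by linarith
  rw [← ha] at hμ₁
  obtain ⟨c, hc, hR⟩ := exists_le_minRadius (μ₁ := μ₁) (p := p) hr hs₁ ha hμ₂0
  refine ⟨fun f hf => summable_derivTerm hr hs₁ hs₂ ha ha0 hμ₁ hf,
    fun haμ c₁ c₂ hc₁ hc₁₂ => ?_, fun c₁ c₂ hc₁ hc₁₂ => ?_⟩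
  · have hc₂ : 0 < c₂ := hc₁.trans_le hc₁₂
    refine ⟨?_, fun γ hγ hγμ => ?_⟩
    -- The radius does not involve `γ`; the largest admissible value `μ₁/a` exceeds `1` because `a <
    -- μ₁`.
    · obtain ⟨ε, hε, C, hC, hT⟩ := exists_floor_truncation_of_one_lt hr hp hs₁ hs₂ ha ha0 hβ hβ0
        (γ := μ₁ / a) (by rwa [one_lt_div ha0]) (by rw [div_mul_cancel₀ _ ha0.ne']) hc₁ hc₂
      refine ⟨min c (c / c₂ ^ a), by positivity, C, hC, fun δ hδ _ N hN h1 h2 => ?_⟩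
      obtain ⟨h3, h4, h5⟩ := hT δ hδ N h1 h2
      have h6 := minRadius_le_truncError (s := s) (μ₁ := μ₁) (μ₂ := μ₂) (p := p) (δ := δ) h3
      have hN0 : (0 : ℝ) < N := by exact_mod_cast hN
      refine ⟨le_trans (ENNReal.ofReal_le_ofReal ?_) (hR N hN δ), h6.trans h4,
        le_trans (ENNReal.ofReal_le_ofReal ?_) (hR N hN δ), h6.trans h5⟩
      · gcongr
        exact min_le_left _ _
      · calc _ ≤ c / c₂ ^ a * (c₂ ^ a * (N : ℝ) ^ (-a)) := by
              gcongr
              · exact min_le_right _ _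
              · exact rpow_div_le_of_le_mul hδ ha0 hc₂ hN0 h2
          _ = _ := by field_simp
    · have hγa : γ * a ≤ μ₁ := by rwa [le_div_iff₀ ha0] at hγμ
      refine ⟨?_, ?_⟩
      · obtain ⟨C₁, hC₁, hl⟩ := exists_le_truncError (μ₁ := μ₁) (β := β) (p := p) hr hs₁ ha ha0
          hμ₂0 hγ hc₂
        obtain ⟨C₂, hC₂, hu⟩ := exists_truncError_le_rpow hr hp hs₁ hs₂ ha ha0 hβ hβ0 hγ.le hγa
          hc₁ hc₂
        refine ⟨C₁, hC₁, C₂, hC₂, fun δ hδ _ n h1 h2 => ⟨hl δ hδ n ?_ h2,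
          hu δ hδ n (h1.trans (le_max_right _ _)) h2⟩⟩
        have : (0 : ℝ) < n := lt_of_lt_of_le (by positivity) h1
        exact_mod_cast this
      · obtain ⟨ε, hε, C, hC, hT⟩ := exists_floor_truncation_of_one_lt hr hp hs₁ hs₂ ha ha0 hβ hβ0
          hγ hγa hc₁ hc₂
        -- This `δ₀` forces `ε δ^{-1/β} ≥ 2`, so the floor loses at most half.
        refine ⟨1 / 2 * ε, by positivity, ε, hε, C, hC, (2 / ε) ^ (-β), by positivity,
          fun δ hδ _ hδ₀ N h1 h2 => ⟨⌊ε * δ ^ (-1 / β)⌋₊, ?_, Nat.floor_le (by positivity),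
          hT δ hδ N h1 h2⟩⟩
        have h3 := le_rpow_neg_one_div hδ hβ0 (by positivity) hδ₀
        rw [div_le_iff₀' hε] at h3
        rw [mul_assoc]
        exact half_mul_le_floor h3
  · have hc₂ : 0 < c₂ := hc₁.trans_le hc₁₂
    obtain ⟨ε, hε, C, hC, hT⟩ := exists_floor_truncation_one hr hp hs₁ hs₂ ha ha0 hβ hβ0 hμ₁
      hc₁ hc₂
    refine ⟨?_, ?_, ?_⟩
    · refine ⟨min c (c / c₂ ^ a), by positivity, C, hC, fun δ hδ hδ1 N hN h1 h2 => ?_⟩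
      obtain ⟨h3, h4, h5⟩ := hT δ hδ hδ1 N hN h1 h2
      have h6 := minRadius_le_truncError (s := s) (μ₁ := μ₁) (μ₂ := μ₂) (p := p) (δ := δ) h3
      have hN1 : 1 ≤ N := by omega
      have hN0 : (0 : ℝ) < N := by exact_mod_cast hN1
      have hL : 0 < Real.log (1 / δ) := Real.log_pos (by rw [one_lt_div hδ]; exact hδ1)
      refine ⟨le_trans (ENNReal.ofReal_le_ofReal ?_) (hR N hN1 δ), h6.trans h4,
        le_trans (ENNReal.ofReal_le_ofReal ?_) (hR N hN1 δ), h6.trans h5⟩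
      · gcongr
        exact min_le_left _ _
      · have h7 := rpow_div_le_of_le_mul (K := c₂ * Real.log (1 / δ)) hδ ha0 (by positivity) hN0
          (by linarith)
        rw [Real.mul_rpow hc₂.le hL.le] at h7
        have h8 : Real.log (1 / δ) ^ a * Real.log (1 / δ) ^ (-a) = 1 := by
          rw [← Real.rpow_add hL, add_neg_cancel, Real.rpow_zero]
        calc _ ≤ c / c₂ ^ a * ((c₂ ^ a * Real.log (1 / δ) ^ a * (N : ℝ) ^ (-a)) *
                Real.log (1 / δ) ^ (-a)) := by
              gcongr
              exact min_le_right _ _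
          _ = c / c₂ ^ a * c₂ ^ a * (N : ℝ) ^ (-a) *
                (Real.log (1 / δ) ^ a * Real.log (1 / δ) ^ (-a)) := by ring
          _ = _ := by
              rw [h8]
              field_simp
    · obtain ⟨C', hC', hu⟩ := exists_truncError_le_rpow (μ₁ := μ₁) hr hp hs₁ hs₂ ha ha0 hβ hβ0
        le_rfl
        (by rwa [one_mul]) hc₁ hc₂
      exact ⟨C', hC', fun δ hδ _ n h1 h2 => hu δ hδ n (h1.trans (le_max_right _ _)) h2⟩
    -- The bounds `δ < e^{-1}` and `δ^{-1/β} ≥ 1/c₁` give `N > 1`, hence `N ≥ 2`, which is not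
    -- assumed here; the middle bound handles the floor.
    · refine ⟨1 / 2 * ε, by positivity, ε, hε, C, hC,
        min (Real.exp (-1)) (min ((2 / ε) ^ (-β)) ((1 / c₁) ^ (-β))), by positivity,
        fun δ hδ hδ1 hδ₀ N h1 h2 => ⟨⌊ε * δ ^ (-1 / β)⌋₊, ?_, Nat.floor_le (by positivity),
        hT δ hδ hδ1 N ?_ h1 h2⟩⟩
      · have h3 := le_rpow_neg_one_div hδ hβ0 (by positivity)
          (hδ₀.trans_le ((min_le_right _ _).trans (min_le_left _ _)))
        rw [div_le_iff₀' hε] at h3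
        rw [mul_assoc]
        exact half_mul_le_floor h3
      · have h3 := le_rpow_neg_one_div hδ hβ0 (by positivity)
          (hδ₀.trans_le ((min_le_right _ _).trans (min_le_right _ _)))
        rw [div_le_iff₀' hc₁] at h3
        have h4 : 1 < Real.log (1 / δ) := by
          rw [one_div, Real.log_inv, lt_neg, Real.log_lt_iff_lt_exp hδ]
          exact hδ₀.trans_le (min_le_left _ _)
        have h5 : (1 : ℝ) < N := by nlinarith
        exact_mod_cast h5
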